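/- **Setting.** Let $m,n\in\mathbb N_{\ge1}\cup\{0+,0-\}$. An *Atl $(m,n)$-tangle* is a system of disjoint strings in the annulus between an internal circle $D_1$ with $2m$ marked points and an external circle $D_0$ with $2n$ marked points ($0$ points for $0\pm$). Every marked point is an end of exactly one string; the other strings are closed and non-contractible (loops), so there are no contractible loops. The regions are shaded in checkerboard fashion. Each circle with marked points has a distinguished interval $*_i$ between adjacent points that meets an unshaded region; the region at a circle without marked points is unshaded for $0+$ and shaded for $0-$. Tangles are considered up to orientation-preserving diffeomorphisms of the annulus that preserve each circle with its marked points and distinguished interval, and the shading. Equivalently (this is the form used here), number the marked points clockwise $1,2,\dots$ from $*_i$ and pass to the universal cover: a tangle is a fixed-point-free involution (the pairing of the ends of strings) on the lifted marked points on the two lines of the infinite strip, which is invariant under deck transformations, non-crossing, and compatible with the shading, together with the number of non-contractible loops, and it is considered up to full turns of one circle. The composite $S\circ T$ is obtained by putting $S$ around $T$, joining the strings at the common circle, and recording loops: new non-contractible loops are counted in the tangle, and shaded and unshaded contractible loops are counted separately. An equation $T=T_{III}\circ T_{II}\circ T_I$ between tangles includes that no contractible loop arises. A *cap* (*cup*)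 is a string with both ends on $D_1$ (on $D_0$). Together with a unique interval of that circle it bounds a disc in the annulus, and its *index* is the number of the first point, clockwise, of this interval. Let $\mathrm{capind}(T)$, $\mathrm{cupind}(T)$ be the sets of cap and cup indices. A *through string* joins $D_1$ to $D_0$. Let $\mathrm{ts}_i$ be the first through string counterclockwise from $*_i$ on $D_i$. The *relative star position* $\mathrm{rel}_*(T)$ is defined as follows. If there are $2s>0$ through strings, number them clockwise $1,\dots,2s$ so that $\mathrm{ts}_0$ is the last if it ends at an even point of $D_0$ and the first if it ends at an odd point; then $\mathrm{rel}_*(T)=\lfloor \#\mathrm{ts}_1/2\rfloor \bmod s$, where $\#\mathrm{ts}_1$ is the number of $\mathrm{ts}_1$. If there are none, $\mathrm{rel}_*(T)$ is the pair consisting of the number of non-contractible loops and the shading of the region that meets $D_1$ and either a non-contractible loop or $D_0$. *Type I*: an identity tangle, or a tangle without cups and loops, with at least one cap, such that, if there are through strings, $*_0$ is the interval, among the two at the external end of $\mathrm{ts}_1$, that meets an unshaded region. *Type II*: a tangle without caps and cups. *Type III*: an identity tangle, or a tangle without caps and loops, with at least one cup, such that, if there are through strings, $*_1$ is the interval, among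 the two at the internal end of $\mathrm{ts}_0$, that meets an unshaded region. **Theorem (Atl tangle decomposition).** Every Atl $(m,n)$-tangle $T$ can be written uniquely as $T=T_{III}\circ T_{II}\circ T_I$ with $T_I$ an Atl $(m,l)$-tangle of Type I, $T_{II}$ an Atl $(l,k)$-tangle of Type II and $T_{III}$ an Atl $(k,n)$-tangle of Type III, where $l$, $k$ and the three tangles are all uniquely determined by $T$. Moreover: 1. $T_I$ is the only $(m,l)$-tangle of Type I with $\mathrm{capind}(T_I)=\mathrm{capind}(T)$; 2. $T_{II}$ is the only $(l,k)$-tangle of Type II with $\mathrm{rel}_*(T_{II})=\mathrm{rel}_*(T)$; 3. $T_{III}$ is the only $(k,n)$-tangle of Type III with $\mathrm{cupind}(T_{III})=\mathrm{cupind}(T)$; 4. either $l=k\ge1$ and $T_{II}$ is a power of the rotation (the tangle that joins the first internal to the third external point), possibly the identity, or $l,k\in\{0+,0-\}$ and $T_{II}$ consists of non-contractible loops only. -/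

import Mathlib

/-!
Annular Temperley-Lieb tangles, described through their strings in the universal cover of the
annulus.  The universal cover of the annulus between the internal circle `D₁` and the external
circle `D₀` is an infinite strip whose bottom line covers `D₁` and whose top line covers `D₀`;
"clockwise" on both circles becomes "to the right" on both lines.  A system of disjoint strings
in the annulus is the same thing as a system of disjoint strings in the strip that is invariant
under the deck transformation, and up to isotopy of the strip such a system is the collection of
pairs of end points of its strings, together with the number of non-contractible loops.
-/

namespace Atl

/-- The objects `[n]` with `n ≥ 1`, and `[0+]`, `[0-]`. -/
inductive Obj : Type
  | zeroPlus : Obj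
  | zeroMinus : Obj
  | pos (n : ℕ+) : Obj

/-- Half of the number of marked points on a circle of the given kind. -/
def Obj.half : Obj → ℕ
  | .zeroPlus => 0
  | .zeroMinus => 0
  | .pos n => n

/-- The shading of the region that meets the distinguished interval of a circle (or the whole
circle, if it has no marked points): `0` for unshaded and `1` for shaded. -/
def Obj.shade : Obj → ℕ
  | .zeroPlus => 0
  | .zeroMinus => 1
  | .pos _ => 0

/-- The lifts to the universal cover of the `2 * k.half` marked points of a circle.  The marked
points are numbered clockwise `1, 2, …, 2 * k.half`, starting at the distinguished interval `*`,
and the integer `pos` is a lift of the marked point whose number is congruent to it modulo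
`2 * k.half`.  So the interval between the positions `0` and `1` is a lift of `*`, and the region
on the clockwise side of a marked point is shaded exactly when its number is odd.  There are no
points if `k` is `0+` or `0-`. -/
@[ext] structure Pt (k : Obj) : Type where
  pos : ℤ
  half_pos : 0 < k.half

/-- The deck transformation by `c` turns. -/
def Pt.shift {k : Obj} (c : ℤ) (p : Pt k) : Pt k := ⟨p.pos + c * (2 * k.half), p.half_pos⟩

/-- The number, in `{1, …, 2 * k.half}`, of the marked point below `p`. -/
def Pt.number {k : Obj} (p : Pt k) : ℕ := ((p.pos - 1) % (2 * k.half)).toNat + 1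

/-- The lifted marked points of an annulus: `Sum.inl` for the internal circle `D₁` (with `2m`
points), `Sum.inr` for the external circle `D₀` (with `2n` points). -/
abbrev Vertex (m n : Obj) : Type := Pt m ⊕ Pt n

/-- The deck transformation by `c` turns. -/
def Vertex.shift {m n : Obj} (c : ℤ) : Vertex m n → Vertex m n := Sum.map (Pt.shift c) (Pt.shift c)

/-- Turning only the external circle, by `c` full turns. -/
def Vertex.twist {m n : Obj} (c : ℤ) : Vertex m n → Vertex m n := Sum.map id (Pt.shift c)

/-- The combinatorial data of a picture in the annulus: which lifted marked points are the two ends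
of a string, the number of non-contractible loops, and the numbers of shaded and of unshaded
contractible loops.  The laws of a planar picture are in `Picture.IsAtl`. -/
@[ext] structure Picture (m n : Obj) : Type where
  string : Vertex m n → Vertex m n → Prop
  loops : ℕ
  shadedLoops : ℕ
  unshadedLoops : ℕ

namespace Picture

variable {l m n : Obj}

/-- `p` and `q` are the ends of a through string. -/
def Through (P : Picture m n) (p : Pt m) (q : Pt n) : Prop := P.string (.inl p) (.inr q)

/-- `p`, `q` are the ends of (a lift of) a cap `Λ`, and the interval `∂Λ` runs clockwise from
`p` to `q`.  (A cap together with an interval of `D₁` bounds a disc outside `D₁` exactly when it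
does so in the universal cover, that is, when the interval lifts to the one from `p` to `q`.) -/
def Cap (P : Picture m n) (p q : Pt m) : Prop := P.string (.inl p) (.inl q) ∧ p.pos < q.pos

/-- `p`, `q` are the ends of (a lift of) a cup `V`, and the interval `∂V` runs clockwise from
`p` to `q`. -/
def Cup (P : Picture m n) (p q : Pt n) : Prop := P.string (.inr p) (.inr q) ∧ p.pos < q.pos

/-- The number of caps `Λ` whose interval `∂Λ` contains the distinguished interval of `D₁`. -/
noncomputable def capsOverStar (P : Picture m n) : ℕ :=
  {c : Pt m × Pt m | P.Cap c.1 c.2 ∧ c.1.pos ≤ 0 ∧ 0 < c.2.pos}.ncard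

/-- The number of cups `V` whose interval `∂V` contains the distinguished interval of `D₀`. -/
noncomputable def cupsOverStar (P : Picture m n) : ℕ :=
  {c : Pt n × Pt n | P.Cup c.1 c.2 ∧ c.1.pos ≤ 0 ∧ 0 < c.2.pos}.ncard

/-- The picture is that of an Atl `(m,n)`-tangle: a system of disjoint strings in which every
marked point meets exactly one string, with a consistent shading, and without contractible loops.
* The fields `cap_planar`, `cup_planar`, `through_planar` say that no two strings cross.
* A non-contractible loop would cross every through string (`loops_eq_zero`).
* Shading: on the two sides of a through string the shading can be read off at both of its ends
  (`through_parity`).  If there are no through strings, one can walk from the distinguished interval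
  of `D₁` to that of `D₀` by crossing the caps and cups over these intervals and the
  non-contractible loops, one time each, and the shading changes at every crossing
  (`shade_parity`). -/
structure IsAtl (P : Picture m n) : Prop where
  symm : ∀ v w, P.string v w → P.string w v
  irrefl : ∀ v, ¬ P.string v v
  existsUnique : ∀ v, ∃! w, P.string v w
  periodic : ∀ v w, P.string (Vertex.shift 1 v) (Vertex.shift 1 w) ↔ P.string v w
  cap_planar : ∀ p q r : Pt m, P.Cap p q → p.pos < r.pos → r.pos < q.pos →
    ∃ r' : Pt m, P.string (.inl r) (.inl r') ∧ p.pos < r'.pos ∧ r'.pos < q.pos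
  cup_planar : ∀ p q r : Pt n, P.Cup p q → p.pos < r.pos → r.pos < q.pos →
    ∃ r' : Pt n, P.string (.inr r) (.inr r') ∧ p.pos < r'.pos ∧ r'.pos < q.pos
  through_planar : ∀ p q p' q', P.Through p q → P.Through p' q' → p.pos < p'.pos → q.pos < q'.pos
  loops_eq_zero : ∀ p q, P.Through p q → P.loops = 0
  through_parity : ∀ p q, P.Through p q → Even (p.pos - q.pos)
  shade_parity : (∀ p q, ¬ P.Through p q) →
    Even (m.shade + P.capsOverStar + P.loops + P.cupsOverStar + n.shade)
  shadedLoops_eq : P.shadedLoops = 0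
  unshadedLoops_eq : P.unshadedLoops = 0

/-! ### Composition -/

/-- The lifted marked points after `S` (from `m` to `n`) has been put around `T` (from `l` to `m`):
internal circle, middle circle, external circle. -/
abbrev Stack (l m n : Obj) : Type := Pt l ⊕ Pt m ⊕ Pt n

/-- The marked points of `T` in the stack. -/
def lower : Vertex l m → Stack l m n := Sum.elim .inl (.inr ∘ .inl)

/-- The marked points of `S` in the stack. -/
def upper : Vertex m n → Stack l m n := .inr

/-- The marked points of the composite in the stack. -/
def ends : Vertex l n → Stack l m n := Sum.map id .inr

/-- The marked point `p` of the middle circle. -/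
def mid (p : Pt m) : Stack l m n := .inr (.inl p)

/-- Two points of the stack are joined by a string of `T` or by a string of `S`. -/
def Adj (S : Picture m n) (T : Picture l m) (x y : Stack l m n) : Prop :=
  (∃ v w, T.string v w ∧ x = lower v ∧ y = lower w) ∨
  (∃ v w, S.string v w ∧ x = upper v ∧ y = upper w)

/-- Two points of the stack lie on the same curve, once the strings of `T` and `S` are joined at the
marked points of the middle circle. -/
def Conn (S : Picture m n) (T : Picture l m) : Stack l m n → Stack l m n → Prop :=
  Relation.ReflTransGen (Adj S T)

/-- The set of points of the middle circle on the lifted curve through its point `p`. -/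
def curve (S : Picture m n) (T : Picture l m) (p : Pt m) : Set (Pt m) :=
  {q | Conn S T (mid p) (mid q)}

/-- The curve through the point `p` of the middle circle is a loop, or covers one: it does not run
into the internal or the external circle. -/
def OnLoop (S : Picture m n) (T : Picture l m) (p : Pt m) : Prop :=
  ∀ v : Vertex l n, ¬ Conn S T (mid p) (ends v)

/-- The lifted curves that cover new non-contractible loops.  A simple loop in the annulus
is non-contractible exactly when its preimage in the strip is one infinite curve, and contractible
exactly when its preimage consists of the translates of a closed curve. -/
def essentialCurves (S : Picture m n) (T : Picture l m) : Set (Set (Pt m)) :=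
  {C | C.Infinite ∧ ∃ p, OnLoop S T p ∧ C = curve S T p}

/-- The new contractible loops, each represented by the leftmost point, on the middle circle, of one
of its lifts: the lift in which this point lies in `{1, …, 2 * m.half}`. -/
def contractibleLoops (S : Picture m n) (T : Picture l m) : Set (Pt m) :=
  {p | 1 ≤ p.pos ∧ p.pos ≤ 2 * m.half ∧ OnLoop S T p ∧ (curve S T p).Finite ∧
    ∀ q ∈ curve S T p, p.pos ≤ q.pos}

/-- The composite `S ∘ T`.  The region inside a contractible loop lies on the clockwise side of the
leftmost point of a lift, so the loop is shaded exactly when this point is odd. -/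
noncomputable def comp (S : Picture m n) (T : Picture l m) : Picture l n where
  string v w := v ≠ w ∧ Conn S T (ends v) (ends w)
  loops := S.loops + T.loops + (essentialCurves S T).ncard
  shadedLoops := S.shadedLoops + T.shadedLoops + {p ∈ contractibleLoops S T | Odd p.pos}.ncard
  unshadedLoops :=
    S.unshadedLoops + T.unshadedLoops + {p ∈ contractibleLoops S T | Even p.pos}.ncard

/-! ### Diffeomorphism classes -/

/-- The picture after `c` full turns of the external circle. -/
def twist (c : ℤ) (P : Picture m n) : Picture m n where
  string v w := P.string (Vertex.twist c v) (Vertex.twist c w)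
  loops := P.loops
  shadedLoops := P.shadedLoops
  unshadedLoops := P.unshadedLoops

theorem _root_.Atl.Vertex.twist_twist (a b : ℤ) (v : Vertex m n) :
    Vertex.twist a (Vertex.twist b v) = Vertex.twist (a + b) v := by
  rcases v with p | p
  · rfl
  · simp only [Vertex.twist, Sum.map_inr, Pt.shift, Sum.inr.injEq, Pt.mk.injEq]
    ring

theorem _root_.Atl.Vertex.twist_zero (v : Vertex m n) : Vertex.twist 0 v = v := by
  rcases v with p | p
  · rfl
  · simp [Vertex.twist, Pt.shift]

theorem twist_twist (a b : ℤ) (P : Picture m n) : (P.twist a).twist b = P.twist (a + b) := by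
  simp only [twist, Vertex.twist_twist]

theorem twist_zero (P : Picture m n) : P.twist 0 = P := by
  simp only [twist, Vertex.twist_zero]

/-! ### Cap indices, cup indices, relative star position -/

/-- The set of cap indices: the index of a cap `Λ` is the number of the first point of `∂Λ` in
clockwise order. -/
def capInd (P : Picture m n) : Set ℕ := {i | ∃ p q, P.Cap p q ∧ p.number = i}

/-- The set of cup indices. -/
def cupInd (P : Picture m n) : Set ℕ := {i | ∃ p q, P.Cup p q ∧ p.number = i}

/-- The positions of the internal ends of the through strings. -/
def innerThrough (P : Picture m n) : Set ℤ := {z | ∃ p q, P.Through p q ∧ p.pos = z}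

/-- The positions of the external ends of the through strings. -/
def outerThrough (P : Picture m n) : Set ℤ := {z | ∃ p q, P.Through p q ∧ q.pos = z}

/-- The first through string counterclockwise from the distinguished interval of `D₁`: the
position of its internal end. -/
noncomputable def firstInner (P : Picture m n) : ℤ := sSup {z ∈ P.innerThrough | z ≤ 0}

/-- The first through string counterclockwise from the distinguished interval of `D₀`: the
position of its external end. -/
noncomputable def firstOuter (P : Picture m n) : ℤ := sSup {z ∈ P.outerThrough | z ≤ 0}

/-- The number of through strings. -/
noncomputable def throughCount (P : Picture m n) : ℕ :=
  {z ∈ P.outerThrough | 1 ≤ z ∧ z ≤ 2 * n.half}.ncard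

/-- The number of through strings met clockwise on `D₀` from the distinguished interval up to the
through string that comes first counterclockwise from the distinguished interval of `D₁`. -/
noncomputable def firstInnerRank (P : Picture m n) : ℕ :=
  {z ∈ P.outerThrough | 1 ≤ z ∧ ∃ p q, P.Through p q ∧ p.pos = P.firstInner ∧ z ≤ q.number}.ncard

end Picture

/-- The possible values of the relative star position. -/
inductive RelStar : Type
  | rotation (r : ℕ) : RelStar
  | essential (shaded : Prop) (k : ℕ) : RelStar

namespace Picture

variable {m n : Obj}

open Classical in
/-- The relative star position.  If there are through strings, they are numbered clockwise,
starting at the side of the first through string counterclockwise from the distinguished interval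
of `D₀` on which the region is unshaded (so this string comes last if it ends at an even
point of `D₀`, and first if it ends at an odd point), and the value is half of the number of the
first through string counterclockwise from the distinguished interval of `D₁`, rounded down,
modulo half of the number of through strings.  If there are none, the value
consists of the number of non-contractible loops and of the shading of the region that meets
`D₁` and either a non-contractible loop or `D₀`. -/
noncomputable def relStar (P : Picture m n) : RelStar :=
  if ∃ p q, P.Through p q then
    .rotation (((P.firstInnerRank + (P.firstOuter % 2).toNat) / 2) % (P.throughCount / 2))
  else .essential (Odd (m.shade + P.capsOverStar)) P.loops

/-! ### Identities, rotations, and the two star conditions -/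

/-- The external end of every string starting on `D₁` is obtained by moving `2j` marked points
clockwise. -/
def IsTurn (P : Picture m n) (j : ℤ) : Prop :=
  P.loops = 0 ∧ ∀ p : Pt m, ∃ q : Pt n, P.Through p q ∧ q.pos = p.pos + 2 * j

/-- Follow the first through string counterclockwise from the distinguished interval of `D₁` to
its external end `q`: the interval at `q` which meets an unshaded region is the distinguished
interval of `D₀`.  (Exactly one of the two intervals at `q` is unshaded, so this says that `q` is an
end of the distinguished interval.)  No condition if there are no through strings. -/
def OuterStar (P : Picture m n) : Prop :=
  ∀ p q, P.Through p q → p.pos = P.firstInner → q.number = 1 ∨ q.number = 2 * n.half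

/-- The same condition with the roles of the two circles exchanged. -/
def InnerStar (P : Picture m n) : Prop :=
  ∀ p q, P.Through p q → q.pos = P.firstOuter → p.number = 1 ∨ p.number = 2 * m.half

end Picture

/-- The pictures of Atl tangles, up to diffeomorphisms of the annulus.  Such a diffeomorphism
respects the circles, marked points and distinguished intervals, so what it does to the
strip is, up to isotopy and deck transformations, a number of full turns of one circle. -/
instance atlSetoid (m n : Obj) : Setoid {P : Picture m n // P.IsAtl} where
  r P Q := ∃ c : ℤ, Q.1 = P.1.twist c
  iseqv :=
    { refl := fun P => ⟨0, P.1.twist_zero.symm⟩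
      symm := by
        rintro P Q ⟨c, h⟩
        exact ⟨-c, by rw [h, Picture.twist_twist, add_neg_cancel, Picture.twist_zero]⟩
      trans := by
        rintro P Q R ⟨c, h⟩ ⟨d, h'⟩
        exact ⟨c + d, by rw [h', h, Picture.twist_twist]⟩ }

/-- Atl `(m,n)`-tangles. -/
def Tangle (m n : Obj) : Type := Quotient (atlSetoid m n)

/-! ### The indices and the relative star position do not depend on the picture -/

theorem Pt.number_shift {k : Obj} (c : ℤ) (p : Pt k) : (p.shift c).number = p.number := by
  have h : p.pos + c * (2 * (k.half : ℤ)) - 1 = p.pos - 1 + (2 * (k.half : ℤ)) * c := by ring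
  simp only [Pt.number, Pt.shift, h, Int.add_mul_emod_self_left]

theorem Pt.shift_shift {k : Obj} (a b : ℤ) (p : Pt k) : (p.shift b).shift a = p.shift (a + b) := by
  ext
  simp only [Pt.shift]
  ring

theorem Pt.shift_zero {k : Obj} (p : Pt k) : p.shift 0 = p := by
  ext
  simp [Pt.shift]

theorem Vertex.shift_shift {m n : Obj} (a b : ℤ) (v : Vertex m n) :
    (v.shift b).shift a = v.shift (a + b) := by
  rcases v with p | p
  · exact congrArg Sum.inl (Pt.shift_shift a b p)
  · exact congrArg Sum.inr (Pt.shift_shift a b p)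

theorem Vertex.shift_zero {m n : Obj} (v : Vertex m n) : v.shift 0 = v := by
  rcases v with p | p
  · exact congrArg Sum.inl (Pt.shift_zero p)
  · exact congrArg Sum.inr (Pt.shift_zero p)

namespace Picture

variable {m n : Obj}

theorem IsAtl.periodic_int {P : Picture m n} (h : P.IsAtl) (c : ℤ) (v w : Vertex m n) :
    P.string (v.shift c) (w.shift c) ↔ P.string v w := by
  induction c using Int.induction_on with
  | zero => simp only [Vertex.shift_zero]
  | succ i ih =>
    rw [← ih, ← h.periodic (v.shift i), Vertex.shift_shift, Vertex.shift_shift, add_comm]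
  | pred i ih =>
    rw [← ih, ← h.periodic (v.shift _), Vertex.shift_shift, Vertex.shift_shift]
    simp only [add_sub_cancel]

theorem IsAtl.through_shift {P : Picture m n} (h : P.IsAtl) (c : ℤ) (p : Pt m) (q : Pt n) :
    P.Through (p.shift c) (q.shift c) ↔ P.Through p q :=
  h.periodic_int c (.inl p) (.inr q)

theorem through_twist (P : Picture m n) (c : ℤ) (p : Pt m) (q : Pt n) :
    (P.twist c).Through p q ↔ P.Through p (q.shift c) := Iff.rfl

theorem capInd_twist (P : Picture m n) (c : ℤ) : (P.twist c).capInd = P.capInd := rfl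

theorem cup_twist (P : Picture m n) (c : ℤ) (p q : Pt n) :
    (P.twist c).Cup p q ↔ P.Cup (p.shift c) (q.shift c) := by
  simp only [Cup, twist, Vertex.twist, Sum.map_inr, Pt.shift, add_lt_add_iff_right]

theorem cupInd_twist (P : Picture m n) (c : ℤ) : (P.twist c).cupInd = P.cupInd := by
  ext i
  constructor
  · rintro ⟨p, q, h, rfl⟩
    exact ⟨_, _, (P.cup_twist c p q).1 h, Pt.number_shift c p⟩
  · rintro ⟨p, q, h, rfl⟩
    refine ⟨p.shift (-c), q.shift (-c), (P.cup_twist c _ _).2 ?_, Pt.number_shift _ p⟩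
    simpa only [Pt.shift_shift, add_neg_cancel, Pt.shift_zero] using h

theorem innerThrough_twist (P : Picture m n) (c : ℤ) :
    (P.twist c).innerThrough = P.innerThrough := by
  ext z
  constructor
  · rintro ⟨p, q, h, rfl⟩
    exact ⟨p, _, h, rfl⟩
  · rintro ⟨p, q, h, rfl⟩
    refine ⟨p, q.shift (-c), ?_, rfl⟩
    rw [through_twist, Pt.shift_shift, add_neg_cancel, Pt.shift_zero]
    exact h

theorem outerThrough_twist {P : Picture m n} (hP : P.IsAtl) (c : ℤ) :
    (P.twist c).outerThrough = P.outerThrough := by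
  ext z
  constructor
  · rintro ⟨p, q, h, rfl⟩
    refine ⟨p.shift (-c), q, ?_, rfl⟩
    rwa [← hP.through_shift c, Pt.shift_shift, add_neg_cancel, Pt.shift_zero]
  · rintro ⟨p, q, h, rfl⟩
    exact ⟨p.shift c, q, (hP.through_shift c p q).2 h, rfl⟩

theorem firstInnerRank_twist {P : Picture m n} (hP : P.IsAtl) (c : ℤ) :
    (P.twist c).firstInnerRank = P.firstInnerRank := by
  unfold firstInnerRank
  congr 1
  ext z
  simp only [outerThrough_twist hP, firstInner, innerThrough_twist, Set.mem_ofPred_eq]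
  refine and_congr_right fun _ => and_congr_right fun _ => exists_congr fun p => ?_
  constructor
  · rintro ⟨q, h, h', h''⟩
    exact ⟨q.shift c, h, h', by rwa [Pt.number_shift]⟩
  · rintro ⟨q, h, h', h''⟩
    refine ⟨q.shift (-c), ?_, h', by rwa [Pt.number_shift]⟩
    rw [through_twist, Pt.shift_shift, add_neg_cancel, Pt.shift_zero]
    exact h

theorem exists_through_iff (P : Picture m n) :
    (∃ p q, P.Through p q) ↔ P.innerThrough.Nonempty :=
  ⟨fun ⟨p, q, h⟩ => ⟨p.pos, p, q, h, rfl⟩, fun ⟨_, p, q, h, _⟩ => ⟨p, q, h⟩⟩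

theorem relStar_twist {P : Picture m n} (hP : P.IsAtl) (c : ℤ) :
    (P.twist c).relStar = P.relStar := by
  have hex : (∃ p q, (P.twist c).Through p q) ↔ ∃ p q, P.Through p q := by
    rw [exists_through_iff, exists_through_iff, innerThrough_twist]
  by_cases h : ∃ p q, P.Through p q
  · rw [relStar, relStar, if_pos h, if_pos (hex.2 h), firstInnerRank_twist hP]
    simp only [firstOuter, throughCount, outerThrough_twist hP]
  · rw [relStar, relStar, if_neg h, if_neg (fun h' => h (hex.1 h'))]
    rfl

end Picture

namespace Tangle

variable {l k m n : Obj}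

/-- `P` is a picture of the tangle `T`. -/
def HasPicture (T : Tangle m n) (P : Picture m n) : Prop :=
  ∃ h : P.IsAtl, T = Quotient.mk (atlSetoid m n) ⟨P, h⟩

/-- The set of cap indices of a tangle. -/
def capInd (T : Tangle m n) : Set ℕ :=
  Quotient.lift (s := atlSetoid m n) (fun P => P.1.capInd)
    (fun P Q ⟨c, h⟩ => by simp only [h, Picture.capInd_twist]) T

/-- The set of cup indices of a tangle. -/
def cupInd (T : Tangle m n) : Set ℕ :=
  Quotient.lift (s := atlSetoid m n) (fun P => P.1.cupInd)
    (fun P Q ⟨c, h⟩ => by simp only [h, Picture.cupInd_twist]) T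

/-- The relative star position of a tangle. -/
noncomputable def relStar (T : Tangle m n) : RelStar :=
  Quotient.lift (s := atlSetoid m n) (fun P => P.1.relStar)
    (fun P Q ⟨c, h⟩ => by simp only [h, Picture.relStar_twist P.2]) T

/-- The number of non-contractible loops of a tangle. -/
def loops (T : Tangle m n) : ℕ :=
  Quotient.lift (s := atlSetoid m n) (fun P => P.1.loops)
    (fun P Q ⟨c, h⟩ => by simp only [h, Picture.twist]) T

/-- The identity tangle `id_[n]`. -/
def IsId (T : Tangle m n) : Prop := m = n ∧ ∃ P, T.HasPicture P ∧ P.IsTurn 0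

/-- The tangle is a power of the rotation `t`, which joins the first internal point to the third
external point. -/
def IsRotation (T : Tangle m n) : Prop :=
  m = n ∧ 0 < m.half ∧ ∃ P, T.HasPicture P ∧ ∃ j, P.IsTurn j

/-- Type I: an identity, or no cups, at least one cap, no non-contractible loops, and the
distinguished interval of `D₀` is determined by that of `D₁`. -/
def TypeI (T : Tangle m n) : Prop :=
  T.IsId ∨ (T.cupInd = ∅ ∧ T.capInd.Nonempty ∧ T.loops = 0 ∧ ∃ P, T.HasPicture P ∧ P.OuterStar)

/-- Type II: no caps and no cups. -/
def TypeII (T : Tangle m n) : Prop := T.capInd = ∅ ∧ T.cupInd = ∅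

/-- Type III: an identity, or no caps, at least one cup, no non-contractible loops, and the
distinguished interval of `D₁` is determined by that of `D₀`. -/
def TypeIII (T : Tangle m n) : Prop :=
  T.IsId ∨ (T.capInd = ∅ ∧ T.cupInd.Nonempty ∧ T.loops = 0 ∧ ∃ P, T.HasPicture P ∧ P.InnerStar)

/-- `T = T₃ ∘ T₂ ∘ T₁`.  The boundary circles that are glued are matched by choosing pictures; no
contractible loops arise, because a picture of an Atl tangle does not have any. -/
def IsComposite (T : Tangle m n) (T₁ : Tangle m l) (T₂ : Tangle l k) (T₃ : Tangle k n) : Prop :=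
  ∃ P₁ P₂ P₃, T₁.HasPicture P₁ ∧ T₂.HasPicture P₂ ∧ T₃.HasPicture P₃ ∧
    T.HasPicture (P₃.comp (P₂.comp P₁))

end Tangle

/-- A triple of composable Atl tangles, from `m` to `n`. -/
structure Triple (m n : Obj) : Type where
  l : Obj
  k : Obj
  T₁ : Tangle m l
  T₂ : Tangle l k
  T₃ : Tangle k n

/-- The triple consists of tangles of Types I, II and III with composite `T`. -/
structure Triple.IsDecomposition {m n : Obj} (D : Triple m n) (T : Tangle m n) : Prop where
  typeI : D.T₁.TypeI
  typeII : D.T₂.TypeII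
  typeIII : D.T₃.TypeIII
  composite : T.IsComposite D.T₁ D.T₂ D.T₃

end Atl

namespace Atl

/-! ### Strictly increasing sequences of integers -/

/-! Cut the annulus along one circle just outside all caps and one just inside all cups. The inner
piece keeps the caps, the outer piece the cups, and the middle piece the loops and the way the
through strings are turned. The only freedom is the place of the two new stars; the star conditions
of Types I and III fix it up to full turns. Without through strings, the shading decides between
`0+` and `0-`.

For existence, the ends of the through strings on a circle are enumerated by a strictly increasing
map `ℤ → ℤ`. Caps pair off the points between consecutive ends, so the gaps are even
(`IsAtl.even_gap`). Hence the enumeration can be chosen compatible with the shading and with the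
star (`IsAtl.exists_innerEnum`), and the three pieces glue back to the picture (`IsAtl.glue_parts`).

For uniqueness, no string of a factor returns to a common circle, so composition only joins through
strings and creates no loops (`comp_eq_glue`). The cap indices, the cup indices and the relative
star position of the composite are therefore those of the three factors (`glue_relStar`). Each
factor is determined by its invariant. Cap indices are the opening brackets of a bracket system, so
they determine the caps (`IsAtl.cap_of_cap`). Two enumerations of the remaining points differ by a
translation, which the star condition makes a full turn (`IsInner.exists_eq_twist`). Without caps
and cups the enumeration is onto, hence a translation by some `2j`, and the relative star position
is `j` modulo half the number of points (`turn_relStar`). Type III is Type I turned inside out. -/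

theorem int_translation {f : ℤ → ℤ} (hf : StrictMono f) (hs : Function.Surjective f) (x : ℤ) :
    f x = f 0 + x := by
  have step : ∀ x, f (x + 1) = f x + 1 := by
    intro x
    have h1 : f x < f (x + 1) := hf (by omega)
    obtain ⟨y, hy⟩ := hs (f x + 1)
    have h2 : x < y := hf.lt_iff_lt.1 (by omega)
    have h3 : f (x + 1) ≤ f y := hf.monotone (by omega)
    omega
  induction x using Int.induction_on with
  | zero => simp
  | succ i ih => rw [step, ih]; ring
  | pred i ih =>
    have := step (-(i : ℤ) - 1)
    rw [sub_add_cancel, ih] at this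
    omega

/-- Comparing the two enumerations gives an increasing bijection of `ℤ`, and such a bijection is a
translation. -/
theorem exists_translation {e e' : ℤ → ℤ} (he : StrictMono e) (he' : StrictMono e')
    (h : Set.range e = Set.range e') : ∃ t, ∀ a, e' a = e (a + t) := by
  have h1 : ∀ a, ∃ b, e b = e' a := fun a => by
    have : e' a ∈ Set.range e := h ▸ ⟨a, rfl⟩
    exact this
  choose f hf using h1
  have hmono : StrictMono f := fun a b hab => he.lt_iff_lt.1 (by rw [hf, hf]; exact he' hab)
  have hsurj : Function.Surjective f := by
    intro b
    have : e b ∈ Set.range e' := h ▸ ⟨b, rfl⟩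
    obtain ⟨a, ha⟩ := this
    exact ⟨a, he.injective (by rw [hf, ha])⟩
  refine ⟨f 0, fun a => ?_⟩
  rw [← hf a, int_translation hmono hsurj a, add_comm]

/-- Makes the number of through strings per turn depend only on the set of their ends. -/
theorem period_unique {e e' : ℤ → ℤ} (he : StrictMono e) (he' : StrictMono e')
    (h : Set.range e = Set.range e') {M N N' : ℤ} (hN : ∀ a, e (a + N) = e a + M)
    (hN' : ∀ a, e' (a + N') = e' a + M) : N = N' := by
  obtain ⟨t, ht⟩ := exists_translation he he' h
  have h1 := hN' 0
  rw [ht, ht, ← hN] at h1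
  have := he.injective h1
  omega

/-- A nonempty periodic set of integers is locally finite and unbounded on both sides, hence order
isomorphic to `ℤ`. -/
theorem exists_strictMono_range {I : Set ℤ} {M : ℤ} (hM : 0 < M) (hI : ∀ z, z + M ∈ I ↔ z ∈ I)
    (hne : I.Nonempty) : ∃ e : ℤ → ℤ, StrictMono e ∧ Set.range e = I := by
  classical
  obtain ⟨z, hz⟩ := hne
  have hdown : ∀ z, z - M ∈ I ↔ z ∈ I := fun z => by rw [← hI (z - M), sub_add_cancel]
  have : Nonempty I := ⟨⟨z, hz⟩⟩
  have : NoMaxOrder I := ⟨fun a => ⟨⟨a.1 + M, (hI _).2 a.2⟩, by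
    rw [← Subtype.coe_lt_coe]; simp only; omega⟩⟩
  have : NoMinOrder I := ⟨fun a => ⟨⟨a.1 - M, (hdown _).2 a.2⟩, by
    rw [← Subtype.coe_lt_coe]; simp only; omega⟩⟩
  let : LocallyFiniteOrder I := Subtype.instLocallyFiniteOrder _
  let : SuccOrder I := LinearLocallyFiniteOrder.succOrder I
  let : PredOrder I := LinearLocallyFiniteOrder.predOrder I
  let g : I ≃o ℤ := orderIsoIntOfLinearSuccPredArch
  refine ⟨fun a => (g.symm a).1, fun a b hab => g.symm.strictMono hab, ?_⟩
  ext x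
  constructor
  · rintro ⟨a, rfl⟩
    exact (g.symm a).2
  · intro hx
    exact ⟨g ⟨x, hx⟩, by simp⟩

/-! ### Objects and marked points -/

theorem Obj.eq_of_half {l k : Obj} (hl : 0 < l.half) (h : l.half = k.half) : l = k := by
  rcases l with _ | _ | l <;> rcases k with _ | _ | k <;> simp_all [Obj.half]

theorem Obj.eq_of_shade {l k : Obj} (hl : l.half = 0) (hk : k.half = 0)
    (h : Even (l.shade + k.shade)) : l = k := by
  rcases l with _ | _ | l <;> rcases k with _ | _ | k <;> simp_all [Obj.half, Obj.shade]

theorem Obj.exists_of_parity (s : ℕ) : ∃ l : Obj, l.half = 0 ∧ Even (s + l.shade) := by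
  rcases Nat.even_or_odd s with h | h
  · exact ⟨.zeroPlus, rfl, h⟩
  · exact ⟨.zeroMinus, rfl, h.add_one⟩

theorem Pt.eq_or_of_number {k : Obj} {p : Pt k} (h : p.number = 1 ∨ p.number = 2 * k.half) :
    ∃ c : ℤ, p.pos = c * (2 * k.half) ∨ p.pos = 1 + c * (2 * k.half) := by
  have hk := p.half_pos
  have h0 := Int.emod_nonneg (p.pos - 1) (b := 2 * (k.half : ℤ)) (by omega)
  have h1 := Int.emod_lt_of_pos (p.pos - 1) (b := 2 * (k.half : ℤ)) (by omega)
  have h2 := Int.emod_add_mul_ediv (p.pos - 1) (2 * (k.half : ℤ))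
  rw [mul_comm (2 * (k.half : ℤ))] at h2
  unfold Pt.number at h
  rcases h with h | h
  · exact ⟨(p.pos - 1) / (2 * (k.half : ℤ)), Or.inr (by omega)⟩
  · refine ⟨(p.pos - 1) / (2 * (k.half : ℤ)) + 1, Or.inl ?_⟩
    rw [add_mul]
    omega

theorem Pt.number_of_pos {k : Obj} {p : Pt k} (h : p.pos = 0 ∨ p.pos = 1) :
    p.number = 1 ∨ p.number = 2 * k.half := by
  have hk := p.half_pos
  unfold Pt.number
  rcases h with h | h
  · right
    have : (p.pos - 1) % (2 * (k.half : ℤ)) = 2 * k.half - 1 := by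
      rw [h, ← Int.add_emod_right, Int.emod_eq_of_lt] <;> omega
    omega
  · left
    simp [h]

/-- A marked point has a translate whose position is its number. -/
theorem Pt.exists_shift_number {k : Obj} (p : Pt k) :
    ∃ c : ℤ, (p.number : ℤ) = p.pos + c * (2 * k.half) ∧ 1 ≤ p.number ∧ p.number ≤ 2 * k.half := by
  have hk := p.half_pos
  have h0 := Int.emod_nonneg (p.pos - 1) (b := 2 * (k.half : ℤ)) (by omega)
  have h1 := Int.emod_lt_of_pos (p.pos - 1) (b := 2 * (k.half : ℤ)) (by omega)
  have h2 := Int.emod_add_mul_ediv (p.pos - 1) (2 * (k.half : ℤ))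
  rw [mul_comm (2 * (k.half : ℤ))] at h2
  refine ⟨-((p.pos - 1) / (2 * (k.half : ℤ))), ?_, ?_⟩
  · unfold Pt.number
    rw [neg_mul]
    push_cast
    omega
  · unfold Pt.number
    omega

theorem Pt.exists_shift_of_number_eq {k : Obj} {p q : Pt k} (h : p.number = q.number) :
    ∃ c, q = p.shift c := by
  obtain ⟨c, hc, -⟩ := p.exists_shift_number
  obtain ⟨d, hd, -⟩ := q.exists_shift_number
  refine ⟨c - d, Pt.ext ?_⟩
  simp only [Pt.shift, sub_mul]
  omega

namespace Picture

variable {k l m n : Obj}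

/-! ### Turning a picture inside out -/

/-- Exchange the two circles. -/
def flip (P : Picture m n) : Picture n m where
  string v w := P.string v.swap w.swap
  loops := P.loops
  shadedLoops := P.shadedLoops
  unshadedLoops := P.unshadedLoops

theorem flip_flip (P : Picture m n) : P.flip.flip = P := by
  simp [flip]

theorem IsAtl.uniq {P : Picture m n} (h : P.IsAtl) {v w w' : Vertex m n} (h1 : P.string v w)
    (h2 : P.string v w') : w = w' := (h.existsUnique v).unique h1 h2

theorem IsAtl.flip_through {P : Picture m n} (h : P.IsAtl) (p : Pt n) (q : Pt m) :
    P.flip.Through p q ↔ P.Through q p := ⟨h.symm _ _, h.symm _ _⟩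

theorem swap_shift (c : ℤ) (v : Vertex m n) :
    Sum.swap (Vertex.shift c v) = Vertex.shift c (Sum.swap v) := by
  rcases v with p | p <;> rfl

theorem IsAtl.flip {P : Picture m n} (h : P.IsAtl) : P.flip.IsAtl where
  symm _ _ := h.symm _ _
  irrefl _ := h.irrefl _
  existsUnique v := by
    obtain ⟨w, hw, hu⟩ := h.existsUnique v.swap
    refine ⟨w.swap, by simpa [Picture.flip] using hw, fun w' hw' => ?_⟩
    rw [← hu _ hw', Sum.swap_swap]
  periodic v w := by
    simp only [Picture.flip, swap_shift]
    exact h.periodic _ _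
  cap_planar := h.cup_planar
  cup_planar := h.cap_planar
  through_planar p q p' q' h1 h2 hlt := by
    -- The order law goes from the internal to the external circle. Its converse holds because
    -- reversed internal ends would reverse the external ones, and equal internal ends would force
    -- equal external ones.
    rw [h.flip_through] at h1 h2
    by_contra hge
    rcases lt_or_eq_of_le (not_lt.1 hge) with h3 | h3
    · have := h.through_planar _ _ _ _ h2 h1 h3
      omega
    · obtain rfl : q' = q := Pt.ext h3
      have : (Sum.inr p : Vertex m n) = .inr p' := h.uniq h1 h2
      simp only [Sum.inr.injEq] at this
      subst this
      omega
  loops_eq_zero p q hpq := h.loops_eq_zero q p ((h.flip_through p q).1 hpq)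
  through_parity p q hpq := by
    have := h.through_parity q p ((h.flip_through p q).1 hpq)
    rwa [← neg_sub, even_neg] at this
  shade_parity hno := by
    have := h.shade_parity fun p q hpq => hno q p ((h.flip_through q p).2 hpq)
    have h1 : P.flip.capsOverStar = P.cupsOverStar := rfl
    have h2 : P.flip.cupsOverStar = P.capsOverStar := rfl
    have h3 : P.flip.loops = P.loops := rfl
    rw [h1, h2, h3]
    convert this using 1
    ring
  shadedLoops_eq := h.shadedLoops_eq
  unshadedLoops_eq := h.unshadedLoops_eq

theorem IsAtl.flip_innerThrough {P : Picture m n} (h : P.IsAtl) :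
    P.flip.innerThrough = P.outerThrough := by
  ext z
  constructor
  · rintro ⟨p, q, hpq, rfl⟩
    exact ⟨q, p, (h.flip_through _ _).1 hpq, rfl⟩
  · rintro ⟨p, q, hpq, rfl⟩
    exact ⟨q, p, (h.flip_through _ _).2 hpq, rfl⟩

theorem IsAtl.flip_firstInner {P : Picture m n} (h : P.IsAtl) :
    P.flip.firstInner = P.firstOuter := by
  rw [firstInner, firstOuter, h.flip_innerThrough]

theorem IsAtl.flip_outerStar {P : Picture m n} (h : P.IsAtl) :
    P.flip.OuterStar ↔ P.InnerStar := by
  unfold OuterStar InnerStar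
  rw [h.flip_firstInner]
  constructor
  · exact fun H p q hpq hq => H q p ((h.flip_through _ _).2 hpq) hq
  · exact fun H q p hpq hq => H p q ((h.flip_through _ _).1 hpq) hq

theorem IsAtl.cup_shift {P : Picture m n} (h : P.IsAtl) (c : ℤ) (p q : Pt n) :
    P.Cup (p.shift c) (q.shift c) ↔ P.Cup p q := by
  unfold Cup
  refine and_congr (h.periodic_int c (.inr p) (.inr q)) ?_
  simp [Pt.shift]

theorem IsAtl.twist {P : Picture m n} (h : P.IsAtl) (c : ℤ) : (P.twist c).IsAtl where
  symm _ _ := h.symm _ _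
  irrefl _ := h.irrefl _
  existsUnique v := by
    obtain ⟨w, hw, hu⟩ := h.existsUnique (v.twist c)
    refine ⟨w.twist (-c), ?_, fun w' hw' => ?_⟩
    · simpa [Picture.twist, Vertex.twist_twist, Vertex.twist_zero] using hw
    · rw [← hu _ hw', Vertex.twist_twist, neg_add_cancel, Vertex.twist_zero]
  periodic v w := by
    have : ∀ v : Vertex m n, (v.shift 1).twist c = (v.twist c).shift 1 := by
      rintro (p | p)
      · rfl
      · exact congrArg Sum.inr (by rw [Pt.shift_shift, Pt.shift_shift, add_comm])
    simp only [Picture.twist, this]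
    exact h.periodic _ _
  cap_planar := h.cap_planar
  cup_planar p q r hpq h1 h2 := by
    obtain ⟨r', h3, h4, h5⟩ := h.cup_planar _ _ (r.shift c) ((P.cup_twist c p q).1 hpq)
      (by simpa [Pt.shift] using h1) (by simpa [Pt.shift] using h2)
    refine ⟨r'.shift (-c), ?_, ?_⟩
    · change P.string (.inr (r.shift c)) (.inr ((r'.shift (-c)).shift c))
      rwa [Pt.shift_shift, add_neg_cancel, Pt.shift_zero]
    · simp only [Pt.shift] at h4 h5 ⊢
      rw [neg_mul]
      omega
  through_planar p q p' q' h1 h2 hlt := by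
    have := h.through_planar _ _ _ _ h1 h2 hlt
    simpa [Pt.shift] using this
  loops_eq_zero p q hpq := h.loops_eq_zero _ _ hpq
  through_parity p q hpq := by
    have := h.through_parity _ _ hpq
    have h2 : p.pos - q.pos = p.pos - (q.shift c).pos + (2 * (c * n.half)) := by
      simp only [Pt.shift]
      ring
    rw [h2]
    exact this.add (even_two_mul _)
  shade_parity hno := by
    have h1 : (P.twist c).capsOverStar = P.capsOverStar := rfl
    have h2 : (P.twist c).cupsOverStar = P.cupsOverStar := by
      simp only [cupsOverStar, cup_twist, h.cup_shift]
    rw [h1, h2]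
    refine h.shade_parity fun p q hpq => hno p (q.shift (-c)) ?_
    rwa [through_twist, Pt.shift_shift, add_neg_cancel, Pt.shift_zero]
  shadedLoops_eq := h.shadedLoops_eq
  unshadedLoops_eq := h.unshadedLoops_eq

/-- Up to a deck transformation, turning one circle is turning the other circle the opposite way. -/
theorem IsAtl.flip_twist {P : Picture m n} (h : P.IsAtl) (c : ℤ) :
    (P.twist c).flip = P.flip.twist (-c) := by
  have key : ∀ v w : Vertex n m, P.string (Vertex.twist c v.swap) (Vertex.twist c w.swap) ↔
      P.string (Vertex.twist (-c) v).swap (Vertex.twist (-c) w).swap := by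
    intro v w
    have : ∀ v : Vertex n m,
        Vertex.twist c v.swap = Vertex.shift c (Vertex.twist (-c) v).swap := by
      rintro (p | p)
      · rfl
      · refine congrArg Sum.inl ?_
        rw [Pt.shift_shift, add_neg_cancel, Pt.shift_zero]
        rfl
    rw [this, this, h.periodic_int]
  simp only [Picture.flip, Picture.twist, key]

/-! ### Gluing pictures without cups and without caps at the common circle -/

/-- The strings of a picture form a matching. -/
structure IsMatching (P : Picture m n) : Prop where
  symm : ∀ v w, P.string v w → P.string w v
  irrefl : ∀ v, ¬ P.string v v
  uniq : ∀ v w w', P.string v w → P.string v w' → w = w'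

theorem IsAtl.isMatching {P : Picture m n} (h : P.IsAtl) : P.IsMatching :=
  ⟨h.symm, h.irrefl, fun _ _ _ => h.uniq⟩

/-- No string has both ends on the internal circle. -/
def NoCaps (P : Picture m n) : Prop := ∀ p q, ¬ P.string (.inl p) (.inl q)

/-- No string has both ends on the external circle. -/
def NoCups (P : Picture m n) : Prop := ∀ p q, ¬ P.string (.inr p) (.inr q)

theorem IsAtl.noCaps_iff {P : Picture m n} (h : P.IsAtl) : P.NoCaps ↔ P.capInd = ∅ := by
  rw [Set.eq_empty_iff_forall_notMem]
  constructor
  · rintro H i ⟨p, q, hpq, -⟩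
    exact H p q hpq.1
  · intro H p q hpq
    rcases lt_trichotomy p.pos q.pos with h1 | h1 | h1
    · exact H _ ⟨p, q, ⟨hpq, h1⟩, rfl⟩
    · obtain rfl : p = q := Pt.ext h1
      exact h.irrefl _ hpq
    · exact H _ ⟨q, p, ⟨h.symm _ _ hpq, h1⟩, rfl⟩

theorem IsAtl.noCups_iff {P : Picture m n} (h : P.IsAtl) : P.NoCups ↔ P.cupInd = ∅ :=
  h.flip.noCaps_iff

theorem NoCaps.exists_through {P : Picture m n} (h : P.NoCaps) (hP : P.IsAtl) (p : Pt m) :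
    ∃ q, P.Through p q := by
  obtain ⟨w | w, hw, -⟩ := hP.existsUnique (.inl p)
  · exact (h _ _ hw).elim
  · exact ⟨w, hw⟩

theorem NoCups.exists_through {P : Picture m n} (h : P.NoCups) (hP : P.IsAtl) (q : Pt n) :
    ∃ p, P.Through p q := by
  obtain ⟨w | w, hw, -⟩ := hP.existsUnique (.inr q)
  · exact ⟨w, hP.symm _ _ hw⟩
  · exact (h _ _ hw).elim

/-- The strings obtained by joining the through strings of `T` and `S`. -/
def glueString (S : Picture m n) (T : Picture l m) : Vertex l n → Vertex l n → Prop
  | .inl p, .inl p' => T.string (.inl p) (.inl p')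
  | .inl p, .inr q => ∃ r, T.Through p r ∧ S.Through r q
  | .inr q, .inl p => ∃ r, T.Through p r ∧ S.Through r q
  | .inr q, .inr q' => S.string (.inr q) (.inr q')

/-- The composite of `S` and `T` if no string returns to the common circle. -/
def glue (S : Picture m n) (T : Picture l m) : Picture l n where
  string := glueString S T
  loops := S.loops + T.loops
  shadedLoops := S.shadedLoops + T.shadedLoops
  unshadedLoops := S.unshadedLoops + T.unshadedLoops

/-- Lets a glued picture be the inner factor of a second gluing without first checking its planarity
and shading. -/
theorem IsMatching.glue {S : Picture m n} {T : Picture l m} (hS : S.IsMatching)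
    (hT : T.IsMatching) : (S.glue T).IsMatching where
  symm
    | .inl _, .inl _, h => hT.symm _ _ h
    | .inl _, .inr _, h => h
    | .inr _, .inl _, h => h
    | .inr _, .inr _, h => hS.symm _ _ h
  irrefl
    | .inl _ => hT.irrefl _
    | .inr _ => hS.irrefl _
  uniq
    | .inl _, .inl _, .inl _, h, h' => by
      have := hT.uniq _ _ _ h h'
      simpa using this
    | .inl _, .inl _, .inr _, h, ⟨_, h', _⟩ => by
      have := hT.uniq _ _ _ h h'
      simp at this
    | .inl _, .inr _, .inl _, ⟨_, h', _⟩, h => by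
      have := hT.uniq _ _ _ h h'
      simp at this
    | .inl _, .inr _, .inr _, ⟨_, h1, h2⟩, ⟨_, h3, h4⟩ => by
      have := hT.uniq _ _ _ h1 h3
      simp only [Sum.inr.injEq] at this
      subst this
      have := hS.uniq _ _ _ h2 h4
      simpa using this
    | .inr _, .inl _, .inl _, ⟨_, h1, h2⟩, ⟨_, h3, h4⟩ => by
      have := hS.uniq _ _ _ (hS.symm _ _ h2) (hS.symm _ _ h4)
      simp only [Sum.inl.injEq] at this
      subst this
      have := hT.uniq _ _ _ (hT.symm _ _ h1) (hT.symm _ _ h3)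
      simpa using this
    | .inr _, .inl _, .inr _, ⟨_, _, h'⟩, h => by
      have := hS.uniq _ _ _ h (hS.symm _ _ h')
      simp at this
    | .inr _, .inr _, .inl _, h, ⟨_, _, h'⟩ => by
      have := hS.uniq _ _ _ h (hS.symm _ _ h')
      simp at this
    | .inr _, .inr _, .inr _, h, h' => by
      have := hS.uniq _ _ _ h h'
      simpa using this

/-- The points of the stack on the same curve as an end of the composite. -/
def OnString (S : Picture m n) (T : Picture l m) : Vertex l n → Stack l m n → Prop
  | .inl p, .inl p' => p' = p ∨ T.string (.inl p) (.inl p')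
  | .inl p, .inr (.inl r) => T.Through p r
  | .inl p, .inr (.inr q) => ∃ r, T.Through p r ∧ S.Through r q
  | .inr q, .inl p => ∃ r, T.Through p r ∧ S.Through r q
  | .inr q, .inr (.inl r) => S.Through r q
  | .inr q, .inr (.inr q') => q' = q ∨ S.string (.inr q) (.inr q')

/-- Without returns to the common circle, a curve from an end of the composite crosses that circle
at most once. So the few points listed in `OnString` are already closed under adjacency; each case
is settled by uniqueness of partners. -/
theorem OnString.step {S : Picture m n} {T : Picture l m} (hS : S.IsMatching) (hT : T.IsMatching)
    (hSc : S.NoCaps) (hTc : T.NoCups) {v : Vertex l n} {x y : Stack l m n}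
    (hx : OnString S T v x) (h : Adj S T x y) : OnString S T v y := by
  rcases h with ⟨a, b, hab, rfl, rfl⟩ | ⟨a, b, hab, rfl, rfl⟩ <;>
    rcases v with v | v <;> rcases a with a | a <;> rcases b with b | b <;>
    simp only [OnString, lower, upper, Sum.elim_inl, Sum.elim_inr, Function.comp_apply] at hx ⊢
  · rcases hx with rfl | hx
    · exact Or.inr hab
    · have := hT.uniq _ _ _ (hT.symm _ _ hx) hab
      simp only [Sum.inl.injEq] at this
      exact Or.inl this.symm
  · rcases hx with rfl | hx
    · exact hab
    · have := hT.uniq _ _ _ (hT.symm _ _ hx) hab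
      simp at this
  · have := hT.uniq _ _ _ (hT.symm _ _ hx) hab
    simp only [Sum.inl.injEq] at this
    exact Or.inl this.symm
  · exact (hTc _ _ hab).elim
  · obtain ⟨r, h1, h2⟩ := hx
    have := hT.uniq _ _ _ h1 hab
    simp at this
  · obtain ⟨r, h1, h2⟩ := hx
    have := hT.uniq _ _ _ h1 hab
    simp only [Sum.inr.injEq] at this
    rwa [← this]
  · exact ⟨a, hT.symm _ _ hab, hx⟩
  · exact (hTc _ _ hab).elim
  · exact (hSc _ _ hab).elim
  · exact ⟨a, hx, hab⟩
  · obtain ⟨r, h1, h2⟩ := hx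
    have := hS.uniq _ _ _ (hS.symm _ _ h2) hab
    simp only [Sum.inl.injEq] at this
    rwa [← this]
  · obtain ⟨r, h1, h2⟩ := hx
    have := hS.uniq _ _ _ (hS.symm _ _ h2) hab
    simp at this
  · exact (hSc _ _ hab).elim
  · have := hS.uniq _ _ _ hx hab
    simp only [Sum.inr.injEq] at this
    exact Or.inl this.symm
  · rcases hx with rfl | hx
    · exact hS.symm _ _ hab
    · have := hS.uniq _ _ _ (hS.symm _ _ hx) hab
      simp at this
  · rcases hx with rfl | hx
    · exact Or.inr hab
    · have := hS.uniq _ _ _ (hS.symm _ _ hx) hab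
      simp only [Sum.inr.injEq] at this
      exact Or.inl this.symm

theorem OnString.of_conn {S : Picture m n} {T : Picture l m} (hS : S.IsMatching)
    (hT : T.IsMatching) (hSc : S.NoCaps) (hTc : T.NoCups) {v : Vertex l n} {x : Stack l m n}
    (h : Conn S T (ends v) x) : OnString S T v x := by
  induction h with
  | refl => rcases v with v | v <;> exact Or.inl rfl
  | tail _ h ih => exact ih.step hS hT hSc hTc h

theorem conn_lower {S : Picture m n} {T : Picture l m} {v w : Vertex l m} (h : T.string v w) :
    Conn S T (lower v) (lower w) := Relation.ReflTransGen.single (Or.inl ⟨v, w, h, rfl, rfl⟩)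

theorem conn_upper {S : Picture m n} {T : Picture l m} {v w : Vertex m n} (h : S.string v w) :
    Conn S T (upper v) (upper w) := Relation.ReflTransGen.single (Or.inr ⟨v, w, h, rfl, rfl⟩)

theorem comp_string {S : Picture m n} {T : Picture l m} (hS : S.IsMatching)
    (hT : T.IsMatching) (hSc : S.NoCaps) (hTc : T.NoCups) (v w : Vertex l n) :
    (S.comp T).string v w ↔ glueString S T v w := by
  constructor
  · rintro ⟨hne, hc⟩
    have := OnString.of_conn hS hT hSc hTc hc
    rcases v with v | v <;> rcases w with w | w
    · exact this.resolve_left fun h => hne (congrArg _ h.symm)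
    · exact this
    · exact this
    · exact this.resolve_left fun h => hne (congrArg _ h.symm)
  · intro h
    refine ⟨fun hvw => ((hS.glue hT).irrefl w) (hvw ▸ h), ?_⟩
    rcases v with v | v <;> rcases w with w | w
    · exact conn_lower h
    · obtain ⟨r, h1, h2⟩ := h
      exact (conn_lower h1).trans (conn_upper h2)
    · obtain ⟨r, h1, h2⟩ := h
      exact (conn_upper (hS.symm _ _ h2)).trans (conn_lower (hT.symm _ _ h1))
    · exact conn_upper h

theorem comp_eq_glue {S : Picture m n} {T : Picture l m} (hS : S.IsAtl)
    (hT : T.IsMatching) (hSc : S.NoCaps) (hTc : T.NoCups) : S.comp T = S.glue T := by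
  -- Every point of the common circle runs along `S` straight to the external circle, so no new loop
  -- of either kind arises.
  have hloop : ∀ p, ¬ OnLoop S T p := by
    intro p hp
    obtain ⟨q, hq⟩ := hSc.exists_through hS p
    exact hp (.inr q) (conn_upper (v := .inl p) (w := .inr q) hq)
  have h1 : essentialCurves S T = ∅ :=
    Set.eq_empty_of_forall_notMem fun C ⟨_, p, hp, _⟩ => hloop p hp
  have h2 : contractibleLoops S T = ∅ :=
    Set.eq_empty_of_forall_notMem fun p hp => hloop p hp.2.2.1
  ext v w
  · exact comp_string hS.isMatching hT hSc hTc v w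
  · simp [comp, glue, h1]
  · simp [comp, glue, h2]
  · simp [comp, glue, h2]

/-- The composite of a picture without cups, one without caps and cups, and one without caps. -/
theorem comp_comp_eq_glue {P₁ : Picture m l} {P₂ : Picture l k} {P₃ : Picture k n}
    (h₁ : P₁.IsAtl) (h₂ : P₂.IsAtl) (h₃ : P₃.IsAtl) (hc₁ : P₁.NoCups) (hc₂ : P₂.NoCaps)
    (hc₂' : P₂.NoCups) (hc₃ : P₃.NoCaps) :
    P₃.comp (P₂.comp P₁) = P₃.glue (P₂.glue P₁) := by
  rw [comp_eq_glue h₂ h₁.isMatching hc₂ hc₁]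
  exact comp_eq_glue h₃ (h₂.isMatching.glue h₁.isMatching) hc₃ hc₂'

/-! ### The caps are determined by the cap indices -/

theorem IsAtl.cap_shift {P : Picture m n} (h : P.IsAtl) (c : ℤ) (p q : Pt m) :
    P.Cap (p.shift c) (q.shift c) ↔ P.Cap p q := h.flip.cup_shift c p q

theorem IsAtl.number_mem_capInd {P : Picture m n} (h : P.IsAtl) (p : Pt m) :
    p.number ∈ P.capInd ↔ ∃ q, P.Cap p q := by
  constructor
  · rintro ⟨p', q', hc, hp⟩
    obtain ⟨c, rfl⟩ := Pt.exists_shift_of_number_eq hp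
    exact ⟨q'.shift c, (h.cap_shift c _ _).2 hc⟩
  · rintro ⟨q, hq⟩
    exact ⟨p, q, hq, rfl⟩

/-- Matching of brackets, recovered from the inside outwards by induction on the length of the cap.
All caps strictly inside the given one are already shared, so the cap of `Q` that opens at `p`
cannot close before `q`. -/
theorem IsAtl.cap_of_cap {P : Picture m l} {Q : Picture m n} (hP : P.IsAtl) (hQ : Q.IsAtl)
    (h : P.capInd = Q.capInd) {p q : Pt m} (hc : P.Cap p q) : Q.Cap p q := by
  have hopen : ∀ p, (∃ q, P.Cap p q) ↔ ∃ q, Q.Cap p q := fun p => by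
    rw [← hP.number_mem_capInd, ← hQ.number_mem_capInd, h]
  induction hd : (q.pos - p.pos).toNat using Nat.strong_induction_on generalizing p q with
  | _ d ih =>
  have hpq := hc.2
  have inner : ∀ r : Pt m, p.pos < r.pos → r.pos < q.pos →
      ∃ r' : Pt m, Q.string (.inl r) (.inl r') ∧ p.pos < r'.pos ∧ r'.pos < q.pos := by
    intro r h1 h2
    obtain ⟨r', h3, h4, h5⟩ := hP.cap_planar p q r hc h1 h2
    refine ⟨r', ?_, h4, h5⟩
    rcases lt_trichotomy r.pos r'.pos with h6 | h6 | h6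
    · exact (ih _ (by omega) ⟨h3, h6⟩ rfl).1
    · rw [Pt.ext h6] at h3
      exact (hP.irrefl _ h3).elim
    · exact hQ.symm _ _ (ih _ (by omega) ⟨hP.symm _ _ h3, h6⟩ rfl).1
  obtain ⟨q', hq'⟩ := (hopen p).1 ⟨q, hc⟩
  rcases lt_trichotomy q'.pos q.pos with h1 | h1 | h1
  · obtain ⟨r', h2, h3, h4⟩ := inner q' hq'.2 h1
    have := hQ.uniq h2 (hQ.symm _ _ hq'.1)
    simp only [Sum.inl.injEq] at this
    subst this
    omega
  · rwa [← Pt.ext h1]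
  -- If the cap of `Q` closes beyond `q`, then `q` has a partner `r` under it. To the left of `q`,
  -- `r` is already matched inside the shared part; to the right, `q` would be an opening bracket,
  -- whereas it closes a cap of `P`.
  · exfalso
    obtain ⟨r, h2, h3, h4⟩ := hQ.cap_planar p q' q hq' hc.2 h1
    rcases lt_trichotomy r.pos q.pos with h5 | h5 | h5
    · obtain ⟨r', h6, h7, h8⟩ := inner r h3 h5
      have := hQ.uniq h6 (hQ.symm _ _ h2)
      simp only [Sum.inl.injEq] at this
      subst this
      omega
    · rw [Pt.ext h5] at h2
      exact hQ.irrefl _ h2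
    · obtain ⟨r', hr'⟩ := (hopen q).2 ⟨r, h2, h5⟩
      have := hP.uniq hr'.1 (hP.symm _ _ hc.1)
      simp only [Sum.inl.injEq] at this
      subst this
      have := hr'.2
      omega

theorem IsAtl.inner_string_iff {P : Picture m l} {Q : Picture m n} (hP : P.IsAtl) (hQ : Q.IsAtl)
    (h : P.capInd = Q.capInd) (p q : Pt m) :
    P.string (.inl p) (.inl q) ↔ Q.string (.inl p) (.inl q) := by
  have key : ∀ {l n : Obj} {P : Picture m l} {Q : Picture m n}, P.IsAtl → Q.IsAtl →
      P.capInd = Q.capInd → ∀ p q, P.string (.inl p) (.inl q) → Q.string (.inl p) (.inl q) := by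
    intro l n P Q hP hQ h p q hs
    rcases lt_trichotomy p.pos q.pos with h6 | h6 | h6
    · exact (hP.cap_of_cap hQ h ⟨hs, h6⟩).1
    · rw [Pt.ext h6] at hs
      exact (hP.irrefl _ hs).elim
    · exact hQ.symm _ _ (hP.cap_of_cap hQ h ⟨hP.symm _ _ hs, h6⟩).1
  exact ⟨key hP hQ h p q, key hQ hP h.symm p q⟩

theorem IsAtl.exists_through_iff_of_capInd {P : Picture m l} {Q : Picture m n} (hP : P.IsAtl)
    (hQ : Q.IsAtl) (h : P.capInd = Q.capInd) (p : Pt m) :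
    (∃ q, P.Through p q) ↔ ∃ q, Q.Through p q := by
  have key : ∀ {n : Obj} {P : Picture m n}, P.IsAtl → ((∃ q, P.Through p q) ↔
      ¬ ∃ q, P.string (.inl p) (.inl q)) := by
    intro n P hP
    constructor
    · rintro ⟨q, hq⟩ ⟨q', hq'⟩
      have := hP.uniq hq hq'
      simp at this
    · intro hno
      obtain ⟨w | w, hw, -⟩ := hP.existsUnique (.inl p)
      · exact (hno ⟨w, hw⟩).elim
      · exact ⟨w, hw⟩
  rw [key hP, key hQ]
  simp only [hP.inner_string_iff hQ h]

theorem IsAtl.capsOverStar_eq {P : Picture m l} {Q : Picture m n} (hP : P.IsAtl) (hQ : Q.IsAtl)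
    (h : P.capInd = Q.capInd) : P.capsOverStar = Q.capsOverStar := by
  simp only [capsOverStar, Cap, hP.inner_string_iff hQ h]

theorem NoCaps.capsOverStar_eq {P : Picture m n} (h : P.NoCaps) : P.capsOverStar = 0 := by
  simp [capsOverStar, Cap, h _ _]

theorem NoCups.cupsOverStar_eq {P : Picture m n} (h : P.NoCups) : P.cupsOverStar = 0 := by
  simp [cupsOverStar, Cup, h _ _]

end Picture

theorem period_mul {e : ℤ → ℤ} {N M : ℤ} (h : ∀ a, e (a + N) = e a + M) (c a : ℤ) :
    e (a + c * N) = e a + c * M := by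
  induction c using Int.induction_on with
  | zero => simp
  | succ i ih =>
    have := h (a + i * N)
    rw [ih] at this
    rw [add_mul, one_mul, ← add_assoc, this]
    ring
  | pred i ih =>
    have := h (a + (-(i : ℤ) - 1) * N)
    rw [show a + (-(i : ℤ) - 1) * N + N = a + -(i : ℤ) * N by ring, ih] at this
    linear_combination -this

namespace Picture

variable {k l m n : Obj}

/-! ### The first through string -/

theorem IsAtl.innerThrough_add {P : Picture m n} (h : P.IsAtl) (c z : ℤ) :
    z + c * (2 * m.half) ∈ P.innerThrough ↔ z ∈ P.innerThrough := by
  have key : ∀ c z : ℤ, z ∈ P.innerThrough → z + c * (2 * m.half) ∈ P.innerThrough := by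
    rintro c _ ⟨p, q, hpq, rfl⟩
    exact ⟨p.shift c, q.shift c, (h.through_shift c p q).2 hpq, rfl⟩
  refine ⟨fun hz => ?_, key c z⟩
  have := key (-c) _ hz
  rwa [neg_mul, add_neg_cancel_right] at this

theorem IsAtl.firstInner_spec {P : Picture m n} (h : P.IsAtl) (hex : ∃ p q, P.Through p q) :
    P.firstInner ∈ P.innerThrough ∧ P.firstInner ≤ 0 ∧
      ∀ z ∈ P.innerThrough, z ≤ 0 → z ≤ P.firstInner := by
  obtain ⟨p, q, hpq⟩ := hex
  have hne : {z ∈ P.innerThrough | z ≤ 0}.Nonempty := by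
    -- A full turn has length at least 2, so `|p.pos|` turns counterclockwise bring the end to a
    -- position at most 0.
    refine ⟨p.pos + -|p.pos| * (2 * m.half), (h.innerThrough_add _ _).2 ⟨p, q, hpq, rfl⟩, ?_⟩
    have h1 := le_abs_self p.pos
    have h2 : (1 : ℤ) ≤ m.half := by exact_mod_cast p.half_pos
    nlinarith [abs_nonneg p.pos]
  have hbdd : BddAbove {z ∈ P.innerThrough | z ≤ 0} := ⟨0, fun z hz => hz.2⟩
  have := Int.csSup_mem hne hbdd
  exact ⟨this.1, this.2, fun z hz hz0 => le_csSup hbdd ⟨hz, hz0⟩⟩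

theorem IsAtl.firstOuter_spec {P : Picture m n} (h : P.IsAtl) (hex : ∃ p q, P.Through p q) :
    P.firstOuter ∈ P.outerThrough ∧ P.firstOuter ≤ 0 ∧
      ∀ z ∈ P.outerThrough, z ≤ 0 → z ≤ P.firstOuter := by
  rw [← h.flip_firstInner, ← h.flip_innerThrough]
  obtain ⟨p, q, hpq⟩ := hex
  exact h.flip.firstInner_spec ⟨q, p, (h.flip_through q p).2 hpq⟩

theorem IsAtl.innerThrough_eq {P : Picture m l} {Q : Picture m n} (hP : P.IsAtl)
    (hQ : Q.IsAtl) (h : P.capInd = Q.capInd) : P.innerThrough = Q.innerThrough := by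
  ext z
  constructor
  · rintro ⟨p, q, hpq, rfl⟩
    obtain ⟨q', hq'⟩ := (hP.exists_through_iff_of_capInd hQ h p).1 ⟨q, hpq⟩
    exact ⟨p, q', hq', rfl⟩
  · rintro ⟨p, q, hpq, rfl⟩
    obtain ⟨q', hq'⟩ := (hP.exists_through_iff_of_capInd hQ h p).2 ⟨q, hpq⟩
    exact ⟨p, q', hq', rfl⟩

theorem IsAtl.ext {P Q : Picture m n} (hP : P.IsAtl) (hQ : Q.IsAtl)
    (h₁ : ∀ p q, P.string (.inl p) (.inl q) ↔ Q.string (.inl p) (.inl q))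
    (h₂ : ∀ p q, P.Through p q ↔ Q.Through p q)
    (h₃ : ∀ p q, P.string (.inr p) (.inr q) ↔ Q.string (.inr p) (.inr q))
    (hl : P.loops = Q.loops) : P = Q := by
  apply Picture.ext
  · funext v w
    rcases v with v | v <;> rcases w with w | w
    · exact propext (h₁ v w)
    · exact propext (h₂ v w)
    · exact propext ⟨fun h => hQ.symm _ _ ((h₂ w v).1 (hP.symm _ _ h)),
        fun h => hP.symm _ _ ((h₂ w v).2 (hQ.symm _ _ h))⟩
    · exact propext (h₃ v w)
  · exact hl
  · rw [hP.shadedLoops_eq, hQ.shadedLoops_eq]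
  · rw [hP.unshadedLoops_eq, hQ.unshadedLoops_eq]

/-! ### Pictures without cups -/

/-- In a picture without cups, the through strings are enumerated by their external ends. -/
theorem NoCups.exists_enum {P : Picture m l} (h : P.NoCups) (hP : P.IsAtl) (hl : 0 < l.half) :
    0 < m.half ∧ ∃ e : ℤ → ℤ, StrictMono e ∧ (∀ p q, P.Through p q ↔ p.pos = e q.pos) ∧
      (∀ a, e (a + 2 * l.half) = e a + 2 * m.half) ∧ ∀ a, Even (e a - a) := by
  choose f hf using h.exists_through hP
  have hiff : ∀ p q, P.Through p q ↔ p = f q := by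
    intro p q
    constructor
    · intro hpq
      have := hP.uniq (hP.symm _ _ hpq) (hP.symm _ _ (hf q))
      simpa using this
    · rintro rfl
      exact hf q
  refine ⟨(f ⟨0, hl⟩).half_pos, fun a => (f ⟨a, hl⟩).pos, ?_, ?_, ?_, ?_⟩
  · intro a b hab
    have h1 := hP.flip.through_planar ⟨a, hl⟩ (f ⟨a, hl⟩) ⟨b, hl⟩ (f ⟨b, hl⟩)
    rw [hP.flip_through, hP.flip_through] at h1
    exact h1 (hf _) (hf _) hab
  · intro p q
    rw [hiff, Pt.ext_iff]
  · intro a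
    have := (hP.through_shift 1 _ _).2 (hf ⟨a, hl⟩)
    rw [hiff] at this
    have h2 : Pt.shift 1 (⟨a, hl⟩ : Pt l) = ⟨a + 2 * l.half, hl⟩ := by simp [Pt.shift]
    rw [h2] at this
    simp only [← this, Pt.shift, one_mul]
  · intro a
    exact hP.through_parity _ _ (hf ⟨a, hl⟩)

/-- No cups and no loops, and the external star is determined by the internal star. -/
structure IsInner (P : Picture m n) : Prop where
  noCups : P.NoCups
  loops : P.loops = 0
  star : P.OuterStar

theorem NoCups.range_enum {P : Picture m l} (h : P.NoCups) (hP : P.IsAtl) {e : ℤ → ℤ}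
    (hl : 0 < l.half) (he : ∀ p q, P.Through p q ↔ p.pos = e q.pos) :
    Set.range e = P.innerThrough := by
  ext z
  constructor
  · rintro ⟨a, rfl⟩
    obtain ⟨p, hp⟩ := h.exists_through hP ⟨a, hl⟩
    exact ⟨p, _, hp, (he _ _).1 hp⟩
  · rintro ⟨p, q, hpq, rfl⟩
    exact ⟨q.pos, ((he _ _).1 hpq).symm⟩

theorem not_through_of_half {P : Picture m l} (hl : l.half = 0) (p : Pt m) (q : Pt l) :
    ¬ P.Through p q := fun _ => by
  have := q.half_pos
  omega

theorem IsInner.shade {P : Picture m l} (h : P.IsInner) (hP : P.IsAtl) (hl : l.half = 0) :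
    Even (m.shade + P.capsOverStar + l.shade) := by
  have := hP.shade_parity (not_through_of_half hl)
  rwa [h.loops, h.noCups.cupsOverStar_eq, add_zero, add_zero] at this

theorem IsInner.half_pos {P : Picture m l} {Q : Picture m k} (hQ : Q.IsInner) (hPA : P.IsAtl)
    (hQA : Q.IsAtl) (h : P.capInd = Q.capInd) (hk : 0 < k.half) : 0 < l.half := by
  obtain ⟨p, hp⟩ := hQ.noCups.exists_through hQA ⟨0, hk⟩
  obtain ⟨q, -⟩ := (hPA.exists_through_iff_of_capInd hQA h p).2 ⟨_, hp⟩
  exact q.half_pos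

/-- Without through strings, the shading outside all caps separates `0+` from `0-`; otherwise the
through strings per turn count the points of the external circle. -/
theorem IsInner.obj_eq {P : Picture m l} {Q : Picture m k} (hP : P.IsInner) (hQ : Q.IsInner)
    (hPA : P.IsAtl) (hQA : Q.IsAtl) (h : P.capInd = Q.capInd) : l = k := by
  rcases Nat.eq_zero_or_pos l.half with hl | hl
  · have hk : k.half = 0 := by
      by_contra hk
      have := hQ.half_pos hPA hQA h (Nat.pos_of_ne_zero hk)
      omega
    have h1 := hP.shade hPA hl
    have h2 := hQ.shade hQA hk
    rw [hPA.capsOverStar_eq hQA h] at h1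
    refine Obj.eq_of_shade hl hk ?_
    rw [Nat.even_add] at *
    tauto
  · have hk := hP.half_pos hQA hPA h.symm hl
    obtain ⟨-, e, he, het, hep, -⟩ := hP.noCups.exists_enum hPA hl
    obtain ⟨-, e', he', het', hep', -⟩ := hQ.noCups.exists_enum hQA hk
    have hr : Set.range e = Set.range e' := by
      rw [hP.noCups.range_enum hPA hl het, hQ.noCups.range_enum hQA hk het',
        hPA.innerThrough_eq hQA h]
    have := period_unique he he' hr hep hep'
    exact Obj.eq_of_half hl (by omega)

/-- The first through string of `D₁` in a picture whose external star is determined by it. -/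
theorem IsInner.exists_firstInner {P : Picture m l} (hP : P.IsInner) (hPA : P.IsAtl) {e : ℤ → ℤ}
    (hl : 0 < l.half) (he : ∀ p q, P.Through p q ↔ p.pos = e q.pos) :
    ∃ c ε : ℤ, (ε = 0 ∨ ε = 1) ∧ P.firstInner = e (ε + c * (2 * l.half)) := by
  obtain ⟨p, hp⟩ := hP.noCups.exists_through hPA ⟨0, hl⟩
  obtain ⟨⟨p, q, hpq, hp1⟩, -⟩ := hPA.firstInner_spec ⟨_, _, hp⟩
  obtain ⟨c, hc | hc⟩ := Pt.eq_or_of_number (hP.star p q hpq hp1)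
  · exact ⟨c, 0, Or.inl rfl, by rw [← hp1, (he _ _).1 hpq, hc, zero_add]⟩
  · exact ⟨c, 1, Or.inr rfl, by rw [← hp1, (he _ _).1 hpq, hc]⟩

/-- Equal cap indices give equal caps and equal sets of through ends, so the two enumerations differ
by a translation `t`. In both, the first through string has an index congruent to 0 or 1 modulo a
full turn, which leaves only parity to decide. -/
theorem IsInner.exists_eq_twist {P Q : Picture m l} (hP : P.IsInner) (hQ : Q.IsInner)
    (hPA : P.IsAtl) (hQA : Q.IsAtl) (h : P.capInd = Q.capInd) : ∃ c, Q = P.twist c := by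
  rcases Nat.eq_zero_or_pos l.half with hl | hl
  · refine ⟨0, ?_⟩
    rw [twist_zero]
    refine hQA.ext hPA (hQA.inner_string_iff hPA h.symm) (fun p q => ?_) (fun p q => ?_) ?_
    · exact iff_of_false (not_through_of_half hl p q) (not_through_of_half hl p q)
    · exact iff_of_false (hQ.noCups p q) (hP.noCups p q)
    · rw [hP.loops, hQ.loops]
  · obtain ⟨-, e, he, het, hep, hev⟩ := hP.noCups.exists_enum hPA hl
    obtain ⟨-, e', he', het', hep', hev'⟩ := hQ.noCups.exists_enum hQA hl
    have hI := hPA.innerThrough_eq hQA h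
    have hr : Set.range e = Set.range e' := by
      rw [hP.noCups.range_enum hPA hl het, hQ.noCups.range_enum hQA hl het', hI]
    obtain ⟨t, ht⟩ := exists_translation he he' hr
    obtain ⟨c, ε, hε, hf⟩ := hP.exists_firstInner hPA hl het
    obtain ⟨c', ε', hε', hf'⟩ := hQ.exists_firstInner hQA hl het'
    have hff : P.firstInner = Q.firstInner := by rw [firstInner, firstInner, hI]
    -- Both indices of the first through string have the parity of its position. Hence `ε = ε'`, and
    -- `t` is a whole number of turns.
    have hte : t = (c - c') * (2 * l.half) := by
      have h1 := hev (ε + c * (2 * l.half))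
      have h2 := hev' (ε' + c' * (2 * l.half))
      rw [← hf] at h1
      rw [← hf', ← hff] at h2
      rw [hff, hf', ht] at hf
      have h3 := he.injective hf
      obtain ⟨r, hr⟩ := h1.sub h2
      have h4 : c * (2 * (l.half : ℤ)) = 2 * (c * l.half) := by ring
      have h5 : c' * (2 * (l.half : ℤ)) = 2 * (c' * l.half) := by ring
      have h6 : ε = ε' := by omega
      rw [sub_mul]
      omega
    refine ⟨c - c', hQA.ext (hPA.twist _) (hQA.inner_string_iff (hPA.twist _) h.symm) (fun p q => ?_)
      (fun p q => ?_) ?_⟩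
    · rw [through_twist, het, het', ht, hte]
      rfl
    · exact iff_of_false (hQ.noCups p q) (hP.noCups _ _)
    · exact hQ.loops.trans hP.loops.symm

/-! ### Pictures without caps and cups -/

/-- With no caps every internal point is a through end, so the enumeration is onto and thus a
translation. Its period gives `l = k`, and the shading makes its amount even. -/
theorem IsAtl.eq_turn {P : Picture l k} (hP : P.IsAtl) (h₁ : P.NoCaps) (h₂ : P.NoCups) :
    (l.half = 0 ∧ k.half = 0) ∨ (0 < l.half ∧ l = k ∧ P.loops = 0 ∧
      ∃ j : ℤ, ∀ p q, P.Through p q ↔ q.pos = p.pos + 2 * j) := by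
  rcases Nat.eq_zero_or_pos k.half with hk | hk
  · refine Or.inl ⟨?_, hk⟩
    by_contra hl
    obtain ⟨q, -⟩ := h₁.exists_through hP ⟨0, Nat.pos_of_ne_zero hl⟩
    have := q.half_pos
    omega
  · obtain ⟨hl, e, he, het, hep, hev⟩ := h₂.exists_enum hP hk
    have hs : Function.Surjective e := by
      intro a
      obtain ⟨q, hq⟩ := h₁.exists_through hP ⟨a, hl⟩
      exact ⟨q.pos, ((het _ _).1 hq).symm⟩
    have htr := int_translation he hs
    have hlk : l = k := by
      have := hep 0
      rw [htr] at this
      exact Obj.eq_of_half hl (by omega)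
    obtain ⟨i, hi⟩ := hev 0
    obtain ⟨p, hp⟩ := h₂.exists_through hP ⟨0, hk⟩
    refine Or.inr ⟨hl, hlk, hP.loops_eq_zero _ _ hp, -i, fun p q => ?_⟩
    rw [het, htr]
    omega

theorem firstInner_of_noCaps {P : Picture m n} (hP : P.IsAtl) (h : P.NoCaps) (hm : 0 < m.half) :
    P.firstInner = 0 := by
  obtain ⟨q, hq⟩ := h.exists_through hP ⟨0, hm⟩
  obtain ⟨-, h1, h2⟩ := hP.firstInner_spec ⟨_, _, hq⟩
  exact le_antisymm h1 (h2 0 ⟨_, q, hq, rfl⟩ le_rfl)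

/-- The picture of an identity tangle. -/
def IsIdentity (P : Picture m n) : Prop := m = n ∧ ∃ c, (P.twist c).IsTurn 0

/-- Identities are exactly the cap-free members of the family `IsInner`. This merges the two
alternatives in the definitions of Types I and III. -/
theorem IsAtl.isIdentity_iff {P : Picture m n} (hP : P.IsAtl) :
    P.IsIdentity ↔ P.NoCaps ∧ P.IsInner := by
  constructor
  · rintro ⟨rfl, c, hl, ht⟩
    have ht' : ∀ p : Pt m, P.Through p (p.shift c) := fun p => by
      obtain ⟨q, hq, hqp⟩ := ht p
      rw [mul_zero, add_zero, ← Pt.ext_iff] at hqp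
      subst hqp
      exact hq
    have hcaps : P.NoCaps := fun p q hpq => by
      have := hP.uniq hpq (ht' p)
      simp at this
    refine ⟨hcaps, fun p q hpq => ?_, hl, fun p q hpq hf => ?_⟩
    · have h1 := hP.symm _ _ (ht' (p.shift (-c)))
      rw [Pt.shift_shift, add_neg_cancel, Pt.shift_zero] at h1
      have := hP.uniq hpq h1
      simp at this
    · rw [firstInner_of_noCaps hP hcaps p.half_pos] at hf
      have := hP.uniq hpq (ht' p)
      simp only [Sum.inr.injEq] at this
      rw [this, Pt.number_shift]
      exact Pt.number_of_pos (Or.inl hf)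
  · rintro ⟨h1, h2⟩
    rcases hP.eq_turn h1 h2.noCups with ⟨hm, hn⟩ | ⟨hm, rfl, hl, j, hj⟩
    · refine ⟨Obj.eq_of_shade hm hn ?_, 0, h2.loops, fun p => ?_⟩
      · simpa [h1.capsOverStar_eq] using h2.shade hP hn
      · have := p.half_pos
        omega
    · refine ⟨rfl, ?_⟩
      have h3 := h2.star ⟨0, hm⟩ ⟨2 * j, hm⟩ ((hj _ _).2 (by simp))
        (firstInner_of_noCaps hP h1 hm).symm
      obtain ⟨c, hc | hc⟩ := Pt.eq_or_of_number h3
      · refine ⟨c, hl, fun p => ⟨p, ?_, by simp⟩⟩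
        rw [through_twist, hj]
        simp only [Pt.shift]
        simp only at hc
        omega
      -- The even position `2 * j` cannot be 1 modulo the even length of a turn.
      · simp only at hc
        have : c * (2 * (m.half : ℤ)) = 2 * (c * m.half) := by ring
        omega

theorem IsAtl.isIdentity_flip {P : Picture m n} (hP : P.IsAtl) (h : P.IsIdentity) :
    P.flip.IsIdentity := by
  obtain ⟨rfl, c, hl, ht⟩ := h
  refine ⟨rfl, -c, hl, fun p => ⟨p, ?_, by simp⟩⟩
  obtain ⟨q, hq, hqp⟩ := ht p
  rw [mul_zero, add_zero, ← Pt.ext_iff] at hqp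
  subst hqp
  rw [through_twist, hP.flip_through, ← hP.through_shift c, Pt.shift_shift, add_neg_cancel,
    Pt.shift_zero]
  exact hq

theorem IsAtl.isIdentity_flip_iff {P : Picture m n} (hP : P.IsAtl) :
    P.flip.IsIdentity ↔ P.IsIdentity :=
  ⟨fun h => P.flip_flip ▸ hP.flip.isIdentity_flip h, hP.isIdentity_flip⟩

/-! ### The relative star position -/

/-- In the indices of `e₀`, the numbering of strings starts just after `b`, the index of the first
outer string. The first inner string ends at index `a + 2 * j`, up to full turns. Their difference,
corrected by `ε₀`, is `2 * j + ε₁` plus a multiple of `2 * N`; halving with rounding removes `ε₁`.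
-/
theorem IsAtl.relStar_eq_rotation {P : Picture m n} (hP : P.IsAtl) {N : ℕ} (hN : 0 < N)
    {e₁ e₀ : ℤ → ℤ} (h₁ : StrictMono e₁) (h₀ : StrictMono e₀) (hm : 0 < m.half) (hn : 0 < n.half)
    (hper : ∀ a, e₀ (a + 2 * N) = e₀ a + 2 * n.half) (hpar : ∀ a, Even (e₀ a - a)) {j : ℤ}
    (ht : ∀ p q, P.Through p q ↔ ∃ a, p.pos = e₁ a ∧ q.pos = e₀ (a + 2 * j)) {c₁ ε₁ c₀ ε₀ : ℤ}
    (hε₁ : ε₁ = 0 ∨ ε₁ = 1) (hf₁ : P.firstInner = e₁ (ε₁ + c₁ * (2 * N)))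
    (hε₀ : ε₀ = 0 ∨ ε₀ = 1) (hf₀ : P.firstOuter = e₀ (ε₀ + c₀ * (2 * N))) :
    P.relStar = .rotation (j % N).toNat := by
  set a := ε₁ + c₁ * (2 * (N : ℤ)) with ha
  set b := ε₀ + c₀ * (2 * (N : ℤ)) with hb
  have hout : ∀ z, z ∈ P.outerThrough ↔ ∃ x, z = e₀ x := by
    intro z
    constructor
    · rintro ⟨p, q, hpq, rfl⟩
      obtain ⟨x, -, hx⟩ := (ht p q).1 hpq
      exact ⟨_, hx⟩
    · rintro ⟨x, rfl⟩
      exact ⟨⟨e₁ (x - 2 * j), hm⟩, ⟨e₀ x, hn⟩, (ht _ _).2 ⟨x - 2 * j, rfl, by simp⟩, rfl⟩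
  have hq : P.Through ⟨e₁ a, hm⟩ ⟨e₀ (a + 2 * j), hn⟩ := (ht _ _).2 ⟨a, rfl, rfl⟩
  obtain ⟨-, hb0, hb1⟩ := hP.firstOuter_spec ⟨_, _, hq⟩
  rw [hf₀] at hb0 hb1
  have hpos : ∀ x, 1 ≤ e₀ x ↔ b < x := by
    intro x
    constructor
    · intro hx
      exact h₀.lt_iff_lt.1 (by omega)
    · intro hx
      by_contra hx'
      have := hb1 (e₀ x) ((hout _).2 ⟨x, rfl⟩) (by omega)
      have := h₀ hx
      omega
  have hle : ∀ x, e₀ x ≤ 2 * n.half ↔ x ≤ b + 2 * N := by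
    intro x
    have h1 := hper (x - 2 * N)
    have h2 := hpos (x - 2 * N)
    rw [sub_add_cancel] at h1
    omega
  have hcard : ∀ x, (e₀ '' Set.Icc (b + 1) x).ncard = (x - b).toNat := by
    intro x
    rw [Set.ncard_image_of_injective _ h₀.injective, Set.ncard_eq_toFinset_card']
    simp
  have hcount : P.throughCount = 2 * N := by
    have : {z ∈ P.outerThrough | 1 ≤ z ∧ z ≤ 2 * (n.half : ℤ)} =
        e₀ '' Set.Icc (b + 1) (b + 2 * N) := by
      ext z
      simp only [Set.mem_ofPred_eq, hout, Set.mem_image, Set.mem_Icc]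
      constructor
      · rintro ⟨⟨x, rfl⟩, h1, h2⟩
        exact ⟨x, ⟨(hpos x).1 h1, (hle x).1 h2⟩, rfl⟩
      · rintro ⟨x, ⟨h1, h2⟩, rfl⟩
        exact ⟨⟨x, rfl⟩, (hpos x).2 h1, (hle x).2 h2⟩
    rw [throughCount, this, hcard]
    omega
  -- `d` turns bring the external end of the first inner string into the window `1, …, 2 * n.half`
  -- in which the rank is counted.
  obtain ⟨d, hd, hd1, hd2⟩ := Pt.exists_shift_number (⟨e₀ (a + 2 * j), hn⟩ : Pt n)
  set ν := (⟨e₀ (a + 2 * j), hn⟩ : Pt n).number with hν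
  simp only [← period_mul hper] at hd
  set x := a + 2 * j + d * (2 * (N : ℤ)) with hx
  have hxb : b < x := (hpos x).1 (by omega)
  have hrank : P.firstInnerRank = (x - b).toNat := by
    rw [← hcard, firstInnerRank]
    congr 1
    ext z
    simp only [Set.mem_ofPred_eq, hout, Set.mem_image, Set.mem_Icc]
    constructor
    · rintro ⟨⟨y, rfl⟩, h1, p, q, hpq, hp, hy⟩
      refine ⟨y, ⟨(hpos y).1 h1, ?_⟩, rfl⟩
      obtain ⟨a', ha1, ha2⟩ := (ht p q).1 hpq
      have haa : a' = a := h₁.injective (by rw [← ha1, hp, hf₁])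
      rw [haa] at ha2
      obtain rfl : q = ⟨e₀ (a + 2 * j), hn⟩ := Pt.ext ha2
      rw [← hν, hd] at hy
      exact h₀.le_iff_le.1 hy
    · rintro ⟨y, ⟨h1, h2⟩, rfl⟩
      refine ⟨⟨y, rfl⟩, (hpos y).2 h1, _, _, hq, hf₁.symm, ?_⟩
      rw [← hν, hd]
      exact h₀.monotone h2
  -- Since `e₀` preserves parity, the parity term in `relStar` is exactly `ε₀`, and it cancels the
  -- one contained in `b`.
  have hmod : P.firstOuter % 2 = ε₀ := by
    rw [hf₀]
    obtain ⟨r, hr⟩ := hpar b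
    have : c₀ * (2 * (N : ℤ)) = 2 * (c₀ * N) := by ring
    omega
  rw [relStar, if_pos ⟨_, _, hq⟩, hcount, hrank, hmod]
  congr 1
  have h1 : (((x - b).toNat + ε₀.toNat : ℕ) : ℤ) = 2 * (j + (c₁ + d - c₀) * N) + ε₁ := by
    push_cast
    rw [Int.toNat_of_nonneg (by omega), Int.toNat_of_nonneg (by omega), hx, hb, ha]
    ring
  have h2 : ((((x - b).toNat + ε₀.toNat) / 2 : ℕ) : ℤ) = j + (c₁ + d - c₀) * N := by
    push_cast at h1 ⊢
    omega
  rw [Nat.mul_div_cancel_left _ two_pos]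
  zify
  rw [Int.toNat_of_nonneg (Int.emod_nonneg _ (by omega))]
  push_cast at h2
  rw [h2, Int.add_mul_emod_self_right]

/-! ### Enumerating the internal ends of the through strings -/

/-- Between two consecutive through strings there is an even number of marked points of `D₁`. -/
theorem IsAtl.even_gap {P : Picture m n} (hP : P.IsAtl) {a b : ℤ} (ha : a ∈ P.innerThrough)
    (hb : b ∈ P.innerThrough) (hab : a < b) (hgap : ∀ z ∈ P.innerThrough, a < z → b ≤ z) :
    Even (b - a - 1) := by
  obtain ⟨pa, qa, hqa, rfl⟩ := ha
  obtain ⟨pb, qb, hqb, rfl⟩ := hb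
  have hm := pa.half_pos
  -- A cap leaving the gap would pass over a through end, against planarity, or end there, against
  -- uniqueness.
  have hpart : ∀ z, pa.pos < z → z < pb.pos → ∃ z', P.string (.inl ⟨z, hm⟩) (.inl ⟨z', hm⟩) ∧
      pa.pos < z' ∧ z' < pb.pos := by
    intro z h1 h2
    obtain ⟨r | r, hr, -⟩ := hP.existsUnique (.inl ⟨z, hm⟩)
    · refine ⟨r.pos, hr, ?_, ?_⟩
      · by_contra h3
        rcases lt_or_eq_of_le (not_lt.1 h3) with h3 | h3
        · obtain ⟨s, hs, -⟩ := hP.cap_planar r ⟨z, hm⟩ pa ⟨hP.symm _ _ hr, by simp only; omega⟩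
            h3 h1
          have := hP.uniq hs hqa
          simp at this
        · obtain rfl := Pt.ext h3
          have := hP.uniq (hP.symm _ _ hr) hqa
          simp at this
      · by_contra h3
        rcases lt_or_eq_of_le (not_lt.1 h3) with h3 | h3
        · obtain ⟨s, hs, -⟩ := hP.cap_planar ⟨z, hm⟩ r pb ⟨hr, by simp only; omega⟩ h2 h3
          have := hP.uniq hs hqb
          simp at this
        · obtain rfl := Pt.ext h3
          have := hP.uniq (hP.symm _ _ hr) hqb
          simp at this
    · have := hgap z ⟨_, r, hr, rfl⟩ h1
      omega
  choose! g hg using hpart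
  -- The caps give a fixed-point-free involution of the gap; summing 1 modulo 2 reads off the parity
  -- of its size.
  have hsum : ∑ _z ∈ Finset.Ioo pa.pos pb.pos, (1 : ZMod 2) = 0 := by
    refine Finset.sum_involution (fun z _ => g z) (fun _ _ => by decide) (fun z hz _ h => ?_)
      (fun z hz => ?_) (fun z hz => ?_)
    · rw [Finset.mem_Ioo] at hz
      have := (hg z hz.1 hz.2).1
      rw [h] at this
      exact hP.irrefl _ this
    · rw [Finset.mem_Ioo] at hz ⊢
      exact (hg z hz.1 hz.2).2
    · rw [Finset.mem_Ioo] at hz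
      have h1 := hg z hz.1 hz.2
      have h2 := hg _ h1.2.1 h1.2.2
      have := hP.uniq h2.1 (hP.symm _ _ h1.1)
      simpa using this
  rw [Finset.sum_const, nsmul_one, ZMod.natCast_eq_zero_iff_even, Int.card_Ioo] at hsum
  obtain ⟨r, hr⟩ := hsum
  exact ⟨r, by omega⟩

/-- The internal ends of the through strings are enumerated by the marked points of a circle of
type `l`, with the distinguished interval next to the first through string counterclockwise from
the distinguished interval of `D₁`; if there are no through strings, then `l` has the shading of
the region outside all caps. -/
structure InnerEnum (P : Picture m n) (l : Obj) (e : ℤ → ℤ) : Prop where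
  mono : StrictMono e
  half_pos : 0 < l.half → 0 < m.half
  period : 0 < l.half → ∀ a, e (a + 2 * l.half) = e a + 2 * m.half
  range : ∀ p : Pt m, (∃ q, P.Through p q) ↔ ∃ b : Pt l, p.pos = e b.pos
  parity : ∀ a, Even (e a - a)
  shade : l.half = 0 → Even (m.shade + P.capsOverStar + l.shade)
  star : 0 < l.half → ∃ ε : ℤ, (ε = 0 ∨ ε = 1) ∧ e ε = P.firstInner

/-- Start from any increasing enumeration `g` of the through ends. Even gaps make the parity of `g a
- a` constant, so a turn contains an even number `N = 2 * s` of them, and `s` is the size of the new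
circle. Only the choice of origin remains. -/
theorem IsAtl.exists_innerEnum {P : Picture m n} (hP : P.IsAtl) : ∃ l e, P.InnerEnum l e := by
  by_cases hex : ∃ p q, P.Through p q
  · obtain ⟨hf, hf0, -⟩ := hP.firstInner_spec hex
    obtain ⟨p₀, q₀, h₀⟩ := hex
    have hm := p₀.half_pos
    have hM : (0 : ℤ) < 2 * m.half := by omega
    have hI : ∀ z : ℤ, z + 2 * m.half ∈ P.innerThrough ↔ z ∈ P.innerThrough := fun z => by
      have := hP.innerThrough_add 1 z
      rwa [one_mul] at this
    obtain ⟨g, hg, hgr⟩ := exists_strictMono_range hM hI ⟨_, hf⟩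
    have hgI : ∀ a, g a ∈ P.innerThrough := fun a => hgr ▸ ⟨a, rfl⟩
    obtain ⟨N, hN⟩ := exists_translation hg (e' := fun a => g a + 2 * m.half)
      (fun a b hab => by simpa using hg hab) (by
        rw [hgr]
        ext z
        rw [← sub_add_cancel z (2 * (m.half : ℤ)), hI, ← hgr]
        simp [eq_sub_iff_add_eq])
    have hstep : ∀ a, Even (g (a + 1) - g a - 1) := fun a => by
      refine hP.even_gap (hgI _) (hgI _) (hg (by omega)) fun z hz hz' => ?_
      rw [← hgr] at hz
      obtain ⟨b, rfl⟩ := hz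
      have := hg.lt_iff_lt.1 hz'
      exact hg.monotone (by omega)
    have hpar : ∀ a, Even (g a - g 0 - a) := by
      intro a
      induction a using Int.induction_on with
      | zero => simp
      | succ i ih =>
        obtain ⟨r, hr⟩ := ih
        obtain ⟨s, hs⟩ := hstep i
        exact ⟨r + s, by omega⟩
      | pred i ih =>
        obtain ⟨r, hr⟩ := ih
        obtain ⟨s, hs⟩ := hstep (-(i : ℤ) - 1)
        rw [sub_add_cancel] at hs
        exact ⟨r - s, by omega⟩
    have hNpos : 0 < N := by
      have := hN 0
      have h1 : g 0 < g (0 + N) := by omega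
      have := hg.lt_iff_lt.1 h1
      omega
    have hNeven : Even N := by
      obtain ⟨r, hr⟩ := hpar (0 + N)
      have := hN 0
      exact ⟨m.half - r, by omega⟩
    obtain ⟨s, hs⟩ := hNeven
    have hs0 : 0 < s.toNat := by omega
    obtain ⟨i, hi⟩ : ∃ i, g i = P.firstInner := by
      have : P.firstInner ∈ Set.range g := hgr ▸ hf
      exact this
    have hhalf : ((Obj.pos ⟨s.toNat, hs0⟩).half : ℤ) = s := by
      change (s.toNat : ℤ) = s
      omega
    -- The first inner string gets its own parity, 0 or 1, as index. This puts it next to the new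
    -- star and makes indices and positions agree in parity everywhere.
    refine ⟨.pos ⟨s.toNat, hs0⟩, fun a => g (a - P.firstInner % 2 + i), ?_, fun _ => hm, ?_, ?_,
      ?_, ?_, ?_⟩
    · exact fun a b hab => hg (by omega)
    · intro _ a
      rw [hhalf, hN]
      congr 1
      omega
    · intro p
      have h1 : (∃ q, P.Through p q) ↔ p.pos ∈ P.innerThrough := by
        constructor
        · rintro ⟨q, hq⟩
          exact ⟨p, q, hq, rfl⟩
        · rintro ⟨p', q, hq, hp⟩
          rw [Pt.ext hp] at hq
          exact ⟨q, hq⟩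
      rw [h1, ← hgr]
      constructor
      · rintro ⟨a, ha⟩
        refine ⟨⟨a + P.firstInner % 2 - i, hs0⟩, ?_⟩
        rw [← ha]
        congr 1
        simp only
        omega
      · rintro ⟨b, hb⟩
        exact ⟨_, hb.symm⟩
    · intro a
      obtain ⟨r, hr⟩ := hpar i
      obtain ⟨t, ht⟩ := hpar (a - P.firstInner % 2 + i)
      exact ⟨t - r + P.firstInner / 2, by omega⟩
    · intro h
      change s.toNat = 0 at h
      omega
    · intro _
      exact ⟨P.firstInner % 2, by omega, by simp [hi]⟩
  · obtain ⟨l, hl, hs⟩ := Obj.exists_of_parity (m.shade + P.capsOverStar)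
    -- With no points on the new circle the enumeration is irrelevant, and `id` satisfies the
    -- remaining laws.
    refine ⟨l, id, strictMono_id, by omega, by omega, fun p => ?_, by simp, fun _ => hs, by omega⟩
    refine iff_of_false (fun h => hex ⟨p, h⟩) ?_
    rintro ⟨b, -⟩
    have := b.half_pos
    omega

/-! ### The inner, middle and outer part of a picture -/

/-- The strings of the inner part: the caps, and a through string for every member of `e`. -/
def innerString (P : Picture m n) (e : ℤ → ℤ) : Vertex m l → Vertex m l → Prop
  | .inl p, .inl p' => P.string (.inl p) (.inl p')
  | .inl p, .inr b => p.pos = e b.pos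
  | .inr b, .inl p => p.pos = e b.pos
  | .inr _, .inr _ => False

/-- The inner part of a picture. -/
def innerPart (P : Picture m n) (l : Obj) (e : ℤ → ℤ) : Picture m l where
  string := P.innerString e
  loops := 0
  shadedLoops := 0
  unshadedLoops := 0

theorem InnerEnum.isAtl_innerPart {P : Picture m n} (hP : P.IsAtl) {e : ℤ → ℤ}
    (he : P.InnerEnum l e) : (P.innerPart l e).IsAtl where
  symm
    | .inl _, .inl _, h => hP.symm _ _ h
    | .inl _, .inr _, h => h
    | .inr _, .inl _, h => h
    | .inr _, .inr _, h => h
  irrefl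
    | .inl _ => hP.irrefl _
    | .inr _ => id
  existsUnique
    | .inl p => by
      obtain ⟨w | w, hw, hu⟩ := hP.existsUnique (.inl p)
      · refine ⟨.inl w, hw, ?_⟩
        rintro (w' | b) hw'
        · simpa using hu _ hw'
        · obtain ⟨q, hq⟩ := (he.range p).2 ⟨b, hw'⟩
          simpa using hu _ hq
      · obtain ⟨b, hb⟩ := (he.range p).1 ⟨w, hw⟩
        refine ⟨.inr b, hb, ?_⟩
        rintro (w' | b') hw'
        · simpa using hu _ hw'
        · exact congrArg Sum.inr (Pt.ext (he.mono.injective (Eq.trans (Eq.symm hw') hb)))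
    | .inr b => by
      refine ⟨.inl ⟨e b.pos, he.half_pos b.half_pos⟩, rfl, ?_⟩
      rintro (p | b') h
      · exact congrArg Sum.inl (Pt.ext h)
      · exact h.elim
  periodic := by
    have key : ∀ (p : Pt m) (b : Pt l),
        (p.shift 1).pos = e (b.shift 1).pos ↔ p.pos = e b.pos := fun p b => by
      simp only [Pt.shift, one_mul, he.period b.half_pos]
      omega
    rintro (p | b) (p' | b')
    · exact hP.periodic (.inl p) (.inl p')
    · exact key p b'
    · exact key p' b
    · rfl
  cap_planar := hP.cap_planar
  cup_planar _ _ _ h := h.1.elim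
  through_planar p q p' q' h h' hlt := by
    change p.pos = e q.pos at h
    change p'.pos = e q'.pos at h'
    exact he.mono.lt_iff_lt.1 (by omega)
  loops_eq_zero _ _ _ := rfl
  through_parity p q h := by
    change p.pos = e q.pos at h
    rw [h]
    exact he.parity _
  shade_parity hno := by
    have hl : l.half = 0 := by
      by_contra hl
      have hl := Nat.pos_of_ne_zero hl
      exact hno ⟨e 0, he.half_pos hl⟩ ⟨0, hl⟩ rfl
    have h1 : (P.innerPart l e).NoCups := fun _ _ h => h
    rw [h1.cupsOverStar_eq]
    exact he.shade hl
  shadedLoops_eq := rfl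
  unshadedLoops_eq := rfl

theorem InnerEnum.isInner_innerPart {P : Picture m n} (hP : P.IsAtl) {e : ℤ → ℤ}
    (he : P.InnerEnum l e) : (P.innerPart l e).IsInner where
  noCups _ _ h := h
  loops := rfl
  star p q h hp := by
    obtain ⟨ε, hε, hf⟩ := he.star q.half_pos
    have hI := (he.isAtl_innerPart hP).innerThrough_eq hP rfl
    rw [firstInner, hI, ← firstInner, ← hf] at hp
    change p.pos = e q.pos at h
    have := he.mono.injective (h.symm.trans hp)
    exact Pt.number_of_pos (by omega)

/-- The strings of the middle part: the through strings, with their ends renumbered. -/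
def middleString (P : Picture m n) (e₁ e₀ : ℤ → ℤ) : Vertex l k → Vertex l k → Prop
  | .inl _, .inl _ => False
  | .inl a, .inr b => ∃ p q, P.Through p q ∧ p.pos = e₁ a.pos ∧ q.pos = e₀ b.pos
  | .inr b, .inl a => ∃ p q, P.Through p q ∧ p.pos = e₁ a.pos ∧ q.pos = e₀ b.pos
  | .inr _, .inr _ => False

/-- The middle part of a picture. -/
def middlePart (P : Picture m n) (l k : Obj) (e₁ e₀ : ℤ → ℤ) : Picture l k where
  string := P.middleString e₁ e₀
  loops := P.loops
  shadedLoops := 0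
  unshadedLoops := 0

theorem IsAtl.exists_outer_iff {P : Picture m n} (hP : P.IsAtl) {e₀ : ℤ → ℤ}
    (h₀ : P.flip.InnerEnum k e₀) (q : Pt n) :
    (∃ p, P.Through p q) ↔ ∃ b : Pt k, q.pos = e₀ b.pos := by
  rw [← h₀.range q]
  simp only [hP.flip_through]

theorem IsAtl.middlePart {P : Picture m n} (hP : P.IsAtl) {e₁ e₀ : ℤ → ℤ}
    (h₁ : P.InnerEnum l e₁) (h₀ : P.flip.InnerEnum k e₀) : (P.middlePart l k e₁ e₀).IsAtl where
  symm
    | .inl _, .inl _, h => h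
    | .inl _, .inr _, h => h
    | .inr _, .inl _, h => h
    | .inr _, .inr _, h => h
  irrefl
    | .inl _ => id
    | .inr _ => id
  existsUnique
    | .inl a => by
      obtain ⟨q, hq⟩ := (h₁.range ⟨e₁ a.pos, h₁.half_pos a.half_pos⟩).2 ⟨a, rfl⟩
      obtain ⟨b, hb⟩ := (hP.exists_outer_iff h₀ q).1 ⟨_, hq⟩
      refine ⟨.inr b, ⟨_, q, hq, rfl, hb⟩, ?_⟩
      rintro (w | w) hw
      · exact hw.elim
      · obtain ⟨p', q', h2, h3, h4⟩ := hw
        obtain rfl : p' = ⟨e₁ a.pos, h₁.half_pos a.half_pos⟩ := Pt.ext h3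
        have := hP.uniq h2 hq
        simp only [Sum.inr.injEq] at this
        subst this
        exact congrArg Sum.inr (Pt.ext (h₀.mono.injective (h4.symm.trans hb)))
    | .inr b => by
      obtain ⟨p, hp⟩ := (hP.exists_outer_iff h₀ ⟨e₀ b.pos, h₀.half_pos b.half_pos⟩).2 ⟨b, rfl⟩
      obtain ⟨a, ha⟩ := (h₁.range p).1 ⟨_, hp⟩
      refine ⟨.inl a, ⟨p, _, hp, ha, rfl⟩, ?_⟩
      rintro (w | w) hw
      · obtain ⟨p', q', h2, h3, h4⟩ := hw
        obtain rfl : q' = ⟨e₀ b.pos, h₀.half_pos b.half_pos⟩ := Pt.ext h4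
        have := hP.uniq (hP.symm _ _ h2) (hP.symm _ _ hp)
        simp only [Sum.inl.injEq] at this
        subst this
        exact congrArg Sum.inl (Pt.ext (h₁.mono.injective (h3.symm.trans ha)))
      · exact hw.elim
  periodic := by
    have key : ∀ (a : Pt l) (b : Pt k),
        (∃ p q, P.Through p q ∧ p.pos = e₁ (a.shift 1).pos ∧ q.pos = e₀ (b.shift 1).pos) ↔
        ∃ p q, P.Through p q ∧ p.pos = e₁ a.pos ∧ q.pos = e₀ b.pos := by
      intro a b
      simp only [Pt.shift, one_mul, h₁.period a.half_pos, h₀.period b.half_pos]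
      constructor
      · rintro ⟨p, q, h, hp, hq⟩
        refine ⟨p.shift (-1), q.shift (-1), (hP.through_shift _ _ _).2 h, ?_, ?_⟩ <;>
          simp only [Pt.shift] <;> omega
      · rintro ⟨p, q, h, hp, hq⟩
        refine ⟨p.shift 1, q.shift 1, (hP.through_shift _ _ _).2 h, ?_, ?_⟩ <;>
          simp only [Pt.shift] <;> omega
    rintro (p | b) (p' | b')
    · rfl
    · exact key p b'
    · exact key p' b
    · rfl
  cap_planar _ _ _ h := h.1.elim
  cup_planar _ _ _ h := h.1.elim
  through_planar := by
    rintro a b a' b' ⟨p, q, h, hp, hq⟩ ⟨p', q', h', hp', hq'⟩ hlt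
    refine h₀.mono.lt_iff_lt.1 ?_
    rw [← hq, ← hq']
    refine hP.through_planar _ _ _ _ h h' ?_
    rw [hp, hp']
    exact h₁.mono hlt
  loops_eq_zero := by
    rintro a b ⟨p, q, h, -⟩
    exact hP.loops_eq_zero p q h
  through_parity := by
    rintro a b ⟨p, q, h, hp, hq⟩
    obtain ⟨r, hr⟩ := hP.through_parity p q h
    obtain ⟨s, hs⟩ := h₁.parity a.pos
    obtain ⟨t, ht⟩ := h₀.parity b.pos
    exact ⟨r - s + t, by omega⟩
  shade_parity hno := by
    have hno' : ∀ p q, ¬ P.Through p q := by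
      intro p q hpq
      obtain ⟨a, ha⟩ := (h₁.range p).1 ⟨q, hpq⟩
      obtain ⟨b, hb⟩ := (hP.exists_outer_iff h₀ q).1 ⟨p, hpq⟩
      exact hno a b ⟨p, q, hpq, ha, hb⟩
    have hl : l.half = 0 := by
      by_contra hl
      have hl := Nat.pos_of_ne_zero hl
      obtain ⟨q, hq⟩ := (h₁.range ⟨e₁ 0, h₁.half_pos hl⟩).2 ⟨⟨0, hl⟩, rfl⟩
      exact hno' _ _ hq
    have hk : k.half = 0 := by
      by_contra hk
      have hk := Nat.pos_of_ne_zero hk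
      obtain ⟨q, hq⟩ := (hP.exists_outer_iff h₀ ⟨e₀ 0, h₀.half_pos hk⟩).2 ⟨⟨0, hk⟩, rfl⟩
      exact hno' _ _ hq
    have h2 : (P.middlePart l k e₁ e₀).NoCaps := fun _ _ h => h
    have h3 : (P.middlePart l k e₁ e₀).NoCups := fun _ _ h => h
    rw [h2.capsOverStar_eq, h3.cupsOverStar_eq]
    have h4 : (P.middlePart l k e₁ e₀).loops = P.loops := rfl
    rw [h4]
    have h5 := h₁.shade hl
    have h6 : Even (n.shade + P.cupsOverStar + k.shade) := h₀.shade hk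
    have h7 := hP.shade_parity hno'
    -- Adding the parity laws of the whole picture, the inner part and the outer part counts the
    -- caps, the cups and the shadings of `m` and `n` twice; what remains is the law of the middle
    -- part.
    rw [Nat.even_iff] at *
    omega
  shadedLoops_eq := rfl
  unshadedLoops_eq := rfl

/-- A through string meets each cutting circle once, at its indices in `e₁` and `e₀`, so joining its
three pieces restores its two ends. The outer part is the inner part of the flipped picture, flipped
back. -/
theorem IsAtl.glue_parts {P : Picture m n} (hP : P.IsAtl) {e₁ e₀ : ℤ → ℤ}
    (h₁ : P.InnerEnum l e₁) (h₀ : P.flip.InnerEnum k e₀) :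
    (P.flip.innerPart k e₀).flip.glue ((P.middlePart l k e₁ e₀).glue (P.innerPart l e₁)) = P := by
  have key : ∀ p q, (∃ b : Pt k, (∃ a : Pt l, p.pos = e₁ a.pos ∧
      ∃ p q, P.Through p q ∧ p.pos = e₁ a.pos ∧ q.pos = e₀ b.pos) ∧ q.pos = e₀ b.pos) ↔
      P.Through p q := by
    intro p q
    constructor
    · rintro ⟨b, ⟨a, hp, p', q', h, hp', hq'⟩, hq⟩
      rwa [Pt.ext (hp.trans hp'.symm), Pt.ext (hq.trans hq'.symm)]
    · intro h
      obtain ⟨a, ha⟩ := (h₁.range p).1 ⟨q, h⟩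
      obtain ⟨b, hb⟩ := (hP.exists_outer_iff h₀ q).1 ⟨p, h⟩
      exact ⟨b, ⟨a, ha, p, q, h, ha, hb⟩, hb⟩
  apply Picture.ext
  · funext v w
    rcases v with v | v <;> rcases w with w | w
    · rfl
    · exact propext (key v w)
    · exact propext ((key w v).trans ⟨hP.symm _ _, hP.symm _ _⟩)
    · rfl
  · simp [glue, Picture.middlePart, innerPart, Picture.flip]
  · simp [glue, Picture.middlePart, innerPart, Picture.flip, hP.shadedLoops_eq]
  · simp [glue, Picture.middlePart, innerPart, Picture.flip, hP.unshadedLoops_eq]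

/-! ### The relative star position of a composite -/

theorem relStar_of_not_through {P : Picture m n} (h : ∀ p q, ¬ P.Through p q) :
    P.relStar = .essential (Odd (m.shade + P.capsOverStar)) P.loops := by
  rw [relStar, if_neg fun ⟨p, q, hpq⟩ => h p q hpq]

theorem turn_relStar {P : Picture l l} (hP : P.IsAtl) (hl : 0 < l.half)
    {j : ℤ} (hj : ∀ p q, P.Through p q ↔ q.pos = p.pos + 2 * j) (h₁ : P.NoCaps) (h₂ : P.NoCups) :
    P.relStar = .rotation (j % l.half).toNat := by
  refine hP.relStar_eq_rotation hl strictMono_id strictMono_id hl hl (fun _ => rfl)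
    (fun a => by simp) (fun p q => ?_) (c₁ := 0) (c₀ := 0) (Or.inl rfl) ?_ (Or.inl rfl) ?_
  · simp [hj]
  · simp [firstInner_of_noCaps hP h₁ hl]
  · rw [← hP.flip_firstInner]
    simp [firstInner_of_noCaps hP.flip h₂ hl]

/-- With through strings, the star conditions put the first strings of the composite next to the
stars of the middle circles, so both sides reduce to the same `j`. Without them, the middle part has
all the loops, and the shading law of `P₁` identifies the region outside its caps with the region at
`l`. -/
theorem glue_relStar {P₁ : Picture m l} {P₂ : Picture l k} {P₃ : Picture k n}
    (h₁ : P₁.IsAtl) (h₂ : P₂.IsAtl) (h₃ : P₃.IsAtl) (hI : P₁.IsInner) (hc : P₂.NoCaps)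
    (hc' : P₂.NoCups) (hO : P₃.flip.IsInner) (hC : (P₃.glue (P₂.glue P₁)).IsAtl) :
    P₂.relStar = (P₃.glue (P₂.glue P₁)).relStar := by
  set C := P₃.glue (P₂.glue P₁)
  rcases h₂.eq_turn hc hc' with ⟨hl, hk⟩ | ⟨hl, rfl, hloops, j, hj⟩
  · have hno : ∀ p q, ¬ C.Through p q := by
      rintro p q ⟨r, -⟩
      have := r.half_pos
      omega
    rw [relStar_of_not_through hno, relStar_of_not_through (not_through_of_half hk), hc.capsOverStar_eq]
    have h4 : C.capsOverStar = P₁.capsOverStar := rfl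
    have h5 : C.loops = P₃.loops + (P₂.loops + P₁.loops) := rfl
    have h6 : P₃.loops = 0 := hO.loops
    have h7 := hI.shade h₁ hl
    rw [h4, h5, h6, hI.loops, zero_add, add_zero, add_zero]
    congr 1
    rw [Nat.even_iff] at h7
    rw [Nat.odd_iff, Nat.odd_iff]
    apply propext
    omega
  · obtain ⟨hm, e₁, he₁, ht₁, -, -⟩ := hI.noCups.exists_enum h₁ hl
    obtain ⟨hn, e₀, he₀, ht₀, hp₀, hev₀⟩ := hO.noCups.exists_enum h₃.flip hl
    obtain ⟨c₁, ε₁, hε₁, hf₁⟩ := hI.exists_firstInner h₁ hl ht₁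
    obtain ⟨c₀, ε₀, hε₀, hf₀⟩ := hO.exists_firstInner h₃.flip hl ht₀
    rw [turn_relStar h₂ hl hj hc hc']
    refine (hC.relStar_eq_rotation hl he₁ he₀ hm hn hp₀ hev₀ (fun p q => ?_)
      (c₁ := c₁) (c₀ := c₀) hε₁ ?_ hε₀ ?_).symm
    · simp only [h₃.flip_through] at ht₀
      constructor
      · rintro ⟨b, ⟨a, hpa, hab⟩, hbq⟩
        have h4 := (ht₀ _ _).1 hbq
        rw [(hj _ _).1 hab] at h4
        exact ⟨a.pos, (ht₁ _ _).1 hpa, h4⟩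
      · rintro ⟨a, hp, hq⟩
        exact ⟨⟨a + 2 * j, hl⟩, ⟨⟨a, hl⟩, (ht₁ _ _).2 hp, (hj _ _).2 rfl⟩, (ht₀ _ _).2 hq⟩
    · rw [← hf₁, firstInner, firstInner, hC.innerThrough_eq h₁ rfl]
    · rw [← hf₀, ← hC.flip_firstInner, firstInner, firstInner,
        hC.flip.innerThrough_eq h₃.flip rfl]

theorem exists_eq_twist_of_relStar {P Q : Picture l k} (hP : P.IsAtl) (hQ : Q.IsAtl)
    (hP₁ : P.NoCaps) (hP₂ : P.NoCups) (hQ₁ : Q.NoCaps) (hQ₂ : Q.NoCups)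
    (h : P.relStar = Q.relStar) : ∃ c, Q = P.twist c := by
  rcases hP.eq_turn hP₁ hP₂ with ⟨hl, hk⟩ | ⟨hl, rfl, hloops, j, hj⟩
  · rw [relStar_of_not_through (not_through_of_half hk), relStar_of_not_through (not_through_of_half hk)] at h
    refine ⟨0, ?_⟩
    rw [twist_zero]
    exact hQ.ext hP (fun p q => iff_of_false (hQ₁ p q) (hP₁ p q))
      (fun p q => iff_of_false (not_through_of_half hk p q) (not_through_of_half hk p q))
      (fun p q => iff_of_false (hQ₂ p q) (hP₂ p q)) (RelStar.essential.inj h).2.symm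
  · rcases hQ.eq_turn hQ₁ hQ₂ with ⟨hl', -⟩ | ⟨-, -, hloops', j', hj'⟩
    · omega
    · rw [turn_relStar hP hl hj hP₁ hP₂, turn_relStar hQ hl hj' hQ₁ hQ₂] at h
      have h1 := RelStar.rotation.inj h
      have h2 := Int.emod_nonneg j (b := (l.half : ℤ)) (by omega)
      have h3 := Int.emod_nonneg j' (b := (l.half : ℤ)) (by omega)
      have h4 : j' % (l.half : ℤ) = j % (l.half : ℤ) := by omega
      -- Equal residues give `j - j' = l.half * c`; moving by `2 * l.half * c` points is `c` full
      -- turns.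
      obtain ⟨c, hc⟩ := Int.ModEq.dvd h4
      refine ⟨c, hQ.ext (hP.twist c) (fun p q => iff_of_false (hQ₁ p q) (hP₁ p q))
        (fun p q => ?_) (fun p q => iff_of_false (hQ₂ p q) (hP₂ _ _)) (hloops'.trans hloops.symm)⟩
      rw [through_twist, hj, hj']
      simp only [Pt.shift]
      have : c * (2 * (l.half : ℤ)) = 2 * (l.half * c) := by ring
      omega

end Picture

/-! ### Tangles and their pictures -/

namespace Tangle

variable {k l m n : Obj}

theorem exists_hasPicture (T : Tangle m n) : ∃ P, T.HasPicture P := by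
  obtain ⟨P, rfl⟩ := Quotient.exists_rep T
  exact ⟨P.1, P.2, rfl⟩

theorem HasPicture.isAtl {T : Tangle m n} {P : Picture m n} (h : T.HasPicture P) : P.IsAtl := h.1

theorem HasPicture.exists_eq_twist {T : Tangle m n} {P Q : Picture m n} (hP : T.HasPicture P)
    (hQ : T.HasPicture Q) : ∃ c, Q = P.twist c := by
  obtain ⟨hPA, rfl⟩ := hP
  obtain ⟨hQA, h⟩ := hQ
  exact Quotient.exact h

theorem HasPicture.eq {T S : Tangle m n} {P : Picture m n} {c : ℤ} (hT : T.HasPicture P)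
    (hS : S.HasPicture (P.twist c)) : T = S := by
  obtain ⟨hPA, rfl⟩ := hT
  obtain ⟨hQA, rfl⟩ := hS
  exact Quotient.sound ⟨c, rfl⟩

theorem HasPicture.twist {T : Tangle m n} {P : Picture m n} (h : T.HasPicture P) (c : ℤ) :
    T.HasPicture (P.twist c) := by
  obtain ⟨hPA, rfl⟩ := h
  exact ⟨hPA.twist c, Quotient.sound ⟨c, rfl⟩⟩

theorem HasPicture.capInd {T : Tangle m n} {P : Picture m n} (h : T.HasPicture P) :
    T.capInd = P.capInd := by
  obtain ⟨hPA, rfl⟩ := h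
  rfl

theorem HasPicture.cupInd {T : Tangle m n} {P : Picture m n} (h : T.HasPicture P) :
    T.cupInd = P.cupInd := by
  obtain ⟨hPA, rfl⟩ := h
  rfl

theorem HasPicture.relStar {T : Tangle m n} {P : Picture m n} (h : T.HasPicture P) :
    T.relStar = P.relStar := by
  obtain ⟨hPA, rfl⟩ := h
  rfl

theorem HasPicture.loops {T : Tangle m n} {P : Picture m n} (h : T.HasPicture P) :
    T.loops = P.loops := by
  obtain ⟨hPA, rfl⟩ := h
  rfl

theorem HasPicture.isId_iff {T : Tangle m n} {P : Picture m n} (h : T.HasPicture P) :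
    T.IsId ↔ P.IsIdentity := by
  refine and_congr_right fun _ => ?_
  constructor
  · rintro ⟨Q, hQ, ht⟩
    obtain ⟨c, rfl⟩ := h.exists_eq_twist hQ
    exact ⟨c, ht⟩
  · rintro ⟨c, ht⟩
    exact ⟨_, h.twist c, ht⟩

theorem _root_.Atl.Picture.outerStar_of_twist {P : Picture m n} {c : ℤ}
    (h : (P.twist c).OuterStar) : P.OuterStar := by
  intro p q hpq hp
  rw [← Pt.number_shift (-c) q]
  refine h p _ ?_ ?_
  · rwa [Picture.through_twist, Pt.shift_shift, add_neg_cancel, Pt.shift_zero]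
  · rwa [Picture.firstInner, Picture.innerThrough_twist]

/-- Turns the type into a condition on any one picture: the identity is the case without caps, and
the star condition does not depend on the picture. -/
theorem HasPicture.typeI_iff {T : Tangle m n} {P : Picture m n} (h : T.HasPicture P) :
    T.TypeI ↔ P.IsInner := by
  have hP := h.isAtl
  rw [TypeI, h.isId_iff, h.cupInd, h.capInd, h.loops, hP.isIdentity_iff, ← hP.noCups_iff,
    Set.nonempty_iff_ne_empty, Ne, ← hP.noCaps_iff]
  constructor
  · rintro (h1 | ⟨h1, -, h2, Q, hQ, hs⟩)
    · exact h1.2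
    · obtain ⟨c, rfl⟩ := h.exists_eq_twist hQ
      exact ⟨h1, h2, Picture.outerStar_of_twist hs⟩
  · intro h1
    by_cases h2 : P.NoCaps
    · exact Or.inl ⟨h2, h1⟩
    · exact Or.inr ⟨h1.noCups, h2, h1.loops, P, h, h1.star⟩

theorem HasPicture.typeII_iff {T : Tangle m n} {P : Picture m n} (h : T.HasPicture P) :
    T.TypeII ↔ P.NoCaps ∧ P.NoCups := by
  rw [TypeII, h.cupInd, h.capInd, h.isAtl.noCaps_iff, h.isAtl.noCups_iff]

theorem HasPicture.typeIII_iff {T : Tangle m n} {P : Picture m n} (h : T.HasPicture P) :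
    T.TypeIII ↔ P.flip.IsInner := by
  have hP := h.isAtl
  rw [TypeIII, h.isId_iff, h.cupInd, h.capInd, h.loops, ← hP.isIdentity_flip_iff,
    hP.flip.isIdentity_iff, ← hP.noCaps_iff, Set.nonempty_iff_ne_empty, Ne, ← hP.noCups_iff]
  constructor
  · rintro (h1 | ⟨h1, -, h2, Q, hQ, hs⟩)
    · exact h1.2
    · obtain ⟨c, rfl⟩ := h.exists_eq_twist hQ
      rw [← hQ.isAtl.flip_outerStar, hP.flip_twist] at hs
      exact ⟨h1, h2, Picture.outerStar_of_twist hs⟩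
  · intro h1
    by_cases h2 : P.NoCups
    · exact Or.inl ⟨h2, h1⟩
    · exact Or.inr ⟨h1.noCups, h2, h1.loops, P, h, hP.flip_outerStar.1 h1.star⟩

/-! ### Tangles of each type are determined by their invariant. -/

theorem TypeI.obj_eq {T : Tangle m l} {S : Tangle m k} (hT : T.TypeI) (hS : S.TypeI)
    (h : T.capInd = S.capInd) : l = k := by
  obtain ⟨P, hP⟩ := T.exists_hasPicture
  obtain ⟨Q, hQ⟩ := S.exists_hasPicture
  rw [hP.typeI_iff] at hT
  rw [hQ.typeI_iff] at hS
  rw [hP.capInd, hQ.capInd] at h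
  exact hT.obj_eq hS hP.isAtl hQ.isAtl h

theorem TypeI.eq {T S : Tangle m l} (hT : T.TypeI) (hS : S.TypeI)
    (h : T.capInd = S.capInd) : T = S := by
  obtain ⟨P, hP⟩ := T.exists_hasPicture
  obtain ⟨Q, hQ⟩ := S.exists_hasPicture
  rw [hP.typeI_iff] at hT
  rw [hQ.typeI_iff] at hS
  rw [hP.capInd, hQ.capInd] at h
  obtain ⟨c, rfl⟩ := hT.exists_eq_twist hS hP.isAtl hQ.isAtl h
  exact hP.eq hQ

theorem TypeIII.obj_eq {T : Tangle l n} {S : Tangle k n} (hT : T.TypeIII) (hS : S.TypeIII)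
    (h : T.cupInd = S.cupInd) : l = k := by
  obtain ⟨P, hP⟩ := T.exists_hasPicture
  obtain ⟨Q, hQ⟩ := S.exists_hasPicture
  rw [hP.typeIII_iff] at hT
  rw [hQ.typeIII_iff] at hS
  rw [hP.cupInd, hQ.cupInd] at h
  exact hT.obj_eq hS hP.isAtl.flip hQ.isAtl.flip h

theorem TypeIII.eq {T S : Tangle l n} (hT : T.TypeIII) (hS : S.TypeIII)
    (h : T.cupInd = S.cupInd) : T = S := by
  obtain ⟨P, hP⟩ := T.exists_hasPicture
  obtain ⟨Q, hQ⟩ := S.exists_hasPicture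
  rw [hP.typeIII_iff] at hT
  rw [hQ.typeIII_iff] at hS
  rw [hP.cupInd, hQ.cupInd] at h
  obtain ⟨c, hc⟩ := hT.exists_eq_twist hS hP.isAtl.flip hQ.isAtl.flip h
  -- Flipping back reverses the sense of the turns.
  have : Q = P.twist (-c) := by
    rw [← Q.flip_flip, hc, hP.isAtl.flip.flip_twist, P.flip_flip]
  subst this
  exact hP.eq hQ

theorem TypeII.eq {T S : Tangle l k} (hT : T.TypeII) (hS : S.TypeII)
    (h : T.relStar = S.relStar) : T = S := by
  obtain ⟨P, hP⟩ := T.exists_hasPicture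
  obtain ⟨Q, hQ⟩ := S.exists_hasPicture
  rw [hP.typeII_iff] at hT
  rw [hQ.typeII_iff] at hS
  rw [hP.relStar, hQ.relStar] at h
  obtain ⟨c, rfl⟩ :=
    Picture.exists_eq_twist_of_relStar hP.isAtl hQ.isAtl hT.1 hT.2 hS.1 hS.2 h
  exact hP.eq hQ

theorem TypeII.isRotation_or {T : Tangle l k} (hT : T.TypeII) :
    T.IsRotation ∨ (l.half = 0 ∧ k.half = 0) := by
  obtain ⟨P, hP⟩ := T.exists_hasPicture
  rw [hP.typeII_iff] at hT
  rcases hP.isAtl.eq_turn hT.1 hT.2 with h | ⟨hl, rfl, hloops, j, hj⟩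
  · exact Or.inr h
  · exact Or.inl ⟨rfl, hl, P, hP, j, hloops, fun p =>
      ⟨⟨p.pos + 2 * j, p.half_pos⟩, (hj _ _).2 rfl, rfl⟩⟩

end Tangle

/-! ### Existence and uniqueness of the decomposition. -/

namespace Triple

variable {m n : Obj}

/-- Gluing leaves the caps of the first factor and the cups of the third untouched, so two of the
equalities hold by definition; only the relative star position needs an argument. -/
theorem IsDecomposition.invariants {D : Triple m n} {T : Tangle m n} (h : D.IsDecomposition T) :
    D.T₁.capInd = T.capInd ∧ D.T₂.relStar = T.relStar ∧ D.T₃.cupInd = T.cupInd := by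
  obtain ⟨P₁, P₂, P₃, h₁, h₂, h₃, hT⟩ := h.composite
  have hI := h₁.typeI_iff.1 h.typeI
  have hII := h₂.typeII_iff.1 h.typeII
  have hIII := h₃.typeIII_iff.1 h.typeIII
  rw [Picture.comp_comp_eq_glue h₁.isAtl h₂.isAtl h₃.isAtl hI.noCups hII.1 hII.2 hIII.noCups] at hT
  rw [hT.capInd, hT.cupInd, hT.relStar, h₁.capInd, h₂.relStar, h₃.cupInd]
  exact ⟨rfl, Picture.glue_relStar h₁.isAtl h₂.isAtl h₃.isAtl hI hII.1 hII.2 hIII hT.isAtl, rfl⟩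

theorem exists_isDecomposition (T : Tangle m n) : ∃ D : Triple m n, D.IsDecomposition T := by
  obtain ⟨P, hP⟩ := T.exists_hasPicture
  have hPA := hP.isAtl
  obtain ⟨l, e₁, h₁⟩ := hPA.exists_innerEnum
  obtain ⟨k, e₀, h₀⟩ := hPA.flip.exists_innerEnum
  have hA₁ := h₁.isAtl_innerPart hPA
  have hA₂ := hPA.middlePart h₁ h₀
  have hA₃ := (h₀.isAtl_innerPart hPA.flip).flip
  have hI₁ := h₁.isInner_innerPart hPA
  have hI₃ := h₀.isInner_innerPart hPA.flip
  have hc : (P.middlePart l k e₁ e₀).NoCaps := fun _ _ h => h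
  have hc' : (P.middlePart l k e₁ e₀).NoCups := fun _ _ h => h
  refine ⟨⟨l, k, Quotient.mk _ ⟨_, hA₁⟩, Quotient.mk _ ⟨_, hA₂⟩, Quotient.mk _ ⟨_, hA₃⟩⟩,
    ?_, ?_, ?_, ?_⟩
  · exact (Tangle.HasPicture.typeI_iff ⟨hA₁, rfl⟩).2 hI₁
  · exact (Tangle.HasPicture.typeII_iff ⟨hA₂, rfl⟩).2 ⟨hc, hc'⟩
  · exact (Tangle.HasPicture.typeIII_iff ⟨hA₃, rfl⟩).2 (by rwa [Picture.flip_flip])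
  · refine ⟨_, _, _, ⟨hA₁, rfl⟩, ⟨hA₂, rfl⟩, ⟨hA₃, rfl⟩, ?_⟩
    rw [Picture.comp_comp_eq_glue hA₁ hA₂ hA₃ hI₁.noCups hc hc' hI₃.noCups,
      hPA.glue_parts h₁ h₀]
    exact hP

theorem IsDecomposition.eq {D E : Triple m n} {T : Tangle m n} (hD : D.IsDecomposition T)
    (hE : E.IsDecomposition T) : D = E := by
  obtain ⟨h1, h2, h3⟩ := hD.invariants
  obtain ⟨h4, h5, h6⟩ := hE.invariants
  have hl := hD.typeI.obj_eq hE.typeI (h1.trans h4.symm)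
  have hk := hD.typeIII.obj_eq hE.typeIII (h3.trans h6.symm)
  obtain ⟨l, k, T₁, T₂, T₃⟩ := D
  obtain ⟨l', k', S₁, S₂, S₃⟩ := E
  simp only at hl hk
  -- The intermediate objects must agree before the tangles can be compared.
  subst hl hk
  obtain rfl : T₁ = S₁ := hD.typeI.eq hE.typeI (h1.trans h4.symm)
  obtain rfl : T₂ = S₂ := hD.typeII.eq hE.typeII (h2.trans h5.symm)
  obtain rfl : T₃ = S₃ := hD.typeIII.eq hE.typeIII (h3.trans h6.symm)
  rfl

end Triple

end Atl

theorem mainTheorem3 {m n : Atl.Obj} (T : Atl.Tangle m n) :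
    (∃! D : Atl.Triple m n, D.IsDecomposition T) ∧
    ∀ D : Atl.Triple m n, D.IsDecomposition T →
      (D.T₁.capInd = T.capInd ∧
        ∀ S : Atl.Tangle m D.l, S.TypeI → S.capInd = T.capInd → S = D.T₁) ∧
      (D.T₂.relStar = T.relStar ∧
        ∀ S : Atl.Tangle D.l D.k, S.TypeII → S.relStar = T.relStar → S = D.T₂) ∧
      (D.T₃.cupInd = T.cupInd ∧
        ∀ S : Atl.Tangle D.k n, S.TypeIII → S.cupInd = T.cupInd → S = D.T₃) ∧
      (D.T₂.IsRotation ∨ (D.l.half = 0 ∧ D.k.half = 0)) := by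
  obtain ⟨D, hD⟩ := Atl.Triple.exists_isDecomposition T
  refine ⟨⟨D, hD, fun E hE => hE.eq hD⟩, fun D hD => ?_⟩
  obtain ⟨h1, h2, h3⟩ := hD.invariants
  exact ⟨⟨h1, fun S hS h => hS.eq hD.typeI (h.trans h1.symm)⟩,
    ⟨h2, fun S hS h => hS.eq hD.typeII (h.trans h2.symm)⟩,
    ⟨h3, fun S hS h => hS.eq hD.typeIII (h.trans h3.symm)⟩, hD.typeII.isRotation_or⟩
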